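/- Let $\mathsf{k}$ be an infinite field, $R=\mathsf{k}[s,t]$, and let $R_n\subseteq R$ be the space of homogeneous polynomials of degree $n$ (including $0$). Let $d\ge 2$, and let $\mu=(\mu_1,\dots,\mu_d)$ be a $d$-part partition of $n$, i.e. integers $1\le\mu_1\le\cdots\le\mu_d$ with $\mu_1+\cdots+\mu_d=n$. A tuple $(a_0,\dots,a_d)\in R_n^{d+1}$ has type $\mu$ if, for the ideal $I=\langle a_0,\dots,a_d\rangle\subseteq R$, there is an exact sequence of graded $R$-modules $$0\longrightarrow\bigoplus_{i=1}^d R(-n-\mu_i)\longrightarrow R(-n)^{d+1}\xrightarrow{(a_0,\dots,a_d)} I\longrightarrow 0 .$$ Let $\mathcal P^{\mu}_{n,d}\subseteq R_n^{d+1}$ be the set of all tuples $(a_0,\dots,a_d)$ of type $\mu$ that are linearly independent over $\mathsf{k}$ and relatively prime in $R$. Identify $R_n^{d+1}$ with $\mathsf{k}^{(d+1)(n+1)}$ through the coefficients of the $a_i$, with the Zariski topology on $\mathsf{k}^{(d+1)(n+1)}$ whose closed sets are the zero loci of polynomials over $\mathsf{k}$. Then $\mathcal P^{\mu}_{n,d}$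 is a Zariski open subset of a subvariety (Zariski closed subset) of $R_n^{d+1}$. Furthermore, $\mathcal P^{\mu}_{n,d}$ is irreducible (in particular nonempty), of dimension $$\dim \mathcal P^{\mu}_{n,d}=(d+1)(n+1)-\sum_{i>j}\max(0,\mu_i-\mu_j-1),$$ where the dimension is the Krull dimension of the coordinate ring $\mathsf{k}[x_1,\dots,x_{(d+1)(n+1)}]/I(\mathcal P^{\mu}_{n,d})$ of its Zariski closure, $I(\mathcal P^{\mu}_{n,d})$ being the ideal of all polynomials that vanish on $\mathcal P^{\mu}_{n,d}$. -/

import Mathlib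

open MvPolynomial
open scoped Topology

namespace MuStrata

/-- The Zariski topology on the affine space `k^σ` of `k`-points: the closed sets are the
zero loci of ideals of polynomials with coefficients in `k`. -/
@[reducible] def zariski (k σ : Type*) [Field k] : TopologicalSpace (σ → k) :=
  TopologicalSpace.ofClosed {Z | ∃ I : Ideal (MvPolynomial σ k), Z = zeroLocus k I}
    ⟨⊤, by simp⟩
    (by
      intro A hA
      refine ⟨⨆ I ∈ {I : Ideal (MvPolynomial σ k) | zeroLocus k I ∈ A}, I, ?_⟩
      ext x
      constructor
      · intro hx
        have h : (⨆ I ∈ {I : Ideal (MvPolynomial σ k) | zeroLocus k I ∈ A}, I)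
            ≤ vanishingIdeal k {x} := by
          refine iSup₂_le fun I hI p hp y hy => ?_
          rw [Set.mem_singleton_iff] at hy
          subst hy
          exact hx _ hI p hp
        exact fun p hp => h hp x rfl
      · intro hx Z hZ
        obtain ⟨I, rfl⟩ := hA hZ
        intro p hp
        exact hx p ((le_iSup₂ (f := fun (I : Ideal (MvPolynomial σ k))
          (_ : I ∈ {I : Ideal (MvPolynomial σ k) | zeroLocus k I ∈ A}) => I) I hZ) hp))
    (by
      rintro _ ⟨I, rfl⟩ _ ⟨J, rfl⟩
      refine ⟨I ⊓ J, ?_⟩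
      ext x
      constructor
      · rintro (hx | hx)
        · exact fun p hp => hx p hp.1
        · exact fun p hp => hx p hp.2
      · intro hx
        by_contra hcon
        rw [Set.mem_union, not_or] at hcon
        obtain ⟨h1, h2⟩ := hcon
        simp only [mem_zeroLocus_iff, not_forall] at h1 h2
        obtain ⟨p, hp, hp0⟩ := h1
        obtain ⟨q, hq, hq0⟩ := h2
        have := hx (p * q) ⟨I.mul_mem_right q hp, J.mul_mem_left p hq⟩
        rw [map_mul] at this
        exact (mul_ne_zero hp0 hq0) this)

/-- The Zariski closed sets are exactly the zero loci of ideals. -/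
theorem isClosed_zariski_iff {k σ : Type*} [Field k] (Z : Set (σ → k)) :
    IsClosed[zariski k σ] Z ↔ ∃ I : Ideal (MvPolynomial σ k), Z = zeroLocus k I := by
  rw [← @isOpen_compl_iff _ _ (zariski k σ)]
  change Zᶜᶜ ∈ {Z | ∃ I : Ideal (MvPolynomial σ k), Z = zeroLocus k I} ↔ _
  rw [compl_compl]
  rfl

/-- The dimension of a (locally closed) subset `S` of the affine space `k^σ`: the Krull dimension
of the coordinate ring `k[x] / I(S)` of its Zariski closure, where `I(S)` is the ideal of all
polynomials that vanish on `S`. -/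
noncomputable def zariskiDim {k σ : Type*} [Field k] (S : Set (σ → k)) : WithBot ℕ∞ :=
  ringKrullDim (MvPolynomial σ k ⧸ vanishingIdeal k S)

/-- `k[s,t]`, with `s = X 0` and `t = X 1`. -/
abbrev R (k : Type*) [Field k] : Type _ := MvPolynomial (Fin 2) k

/-- `R_n`, the space of homogeneous polynomials of degree `n` in `k[s,t]` (including `0`). -/
abbrev Rdeg (k : Type*) [Field k] (n : ℕ) : Submodule k (R k) := homogeneousSubmodule (Fin 2) k n

/-- The exponent of the monomial `s^j t^(n-j)`. -/
noncomputable def expo (n : ℕ) (j : Fin (n + 1)) : Fin 2 →₀ ℕ :=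
  Finsupp.single 0 (j : ℕ) + Finsupp.single 1 (n - (j : ℕ))

theorem expo_injective (n : ℕ) : Function.Injective (expo n) := by
  intro i j h
  have := DFunLike.congr_fun h 0
  simp [expo] at this
  exact Fin.ext this

theorem expo_degree (n : ℕ) (j : Fin (n + 1)) : (expo n j).degree = n := by
  have := j.2
  simp [expo, Finsupp.degree_eq_sum]
  omega

theorem exists_expo {n : ℕ} {m : Fin 2 →₀ ℕ} (hm : m.degree = n) : ∃ j, expo n j = m := by
  rw [Finsupp.degree_eq_sum, Fin.sum_univ_two] at hm
  refine ⟨⟨m 0, by omega⟩, ?_⟩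
  ext i
  fin_cases i
  · simp [expo]
  · simp [expo]
    omega

/-- The identification `R_n ≃ k^(n+1)`; the `j`-th coordinate of a form is the coefficient of
`s^j t^(n-j)`. -/
noncomputable def formCoeffs (k : Type*) [Field k] (n : ℕ) : Rdeg k n ≃ₗ[k] (Fin (n + 1) → k) where
  toFun f j := coeff (expo n j) (f : R k)
  map_add' f g := by ext j; simp
  map_smul' c f := by ext j; simp
  invFun c := ⟨∑ j, monomial (expo n j) (c j),
    Submodule.sum_mem _ fun j _ => isHomogeneous_monomial _ (expo_degree n j)⟩
  left_inv f := by
    apply Subtype.ext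
    ext m
    by_cases hm : m.degree = n
    · obtain ⟨j, rfl⟩ := exists_expo hm
      simp [coeff_sum, coeff_monomial, (expo_injective n).eq_iff]
    · have h1 : coeff m (f : R k) = 0 := IsHomogeneous.coeff_eq_zero f.2 hm
      rw [h1, coeff_sum]
      refine Finset.sum_eq_zero fun j _ => ?_
      rw [coeff_monomial, if_neg]
      rintro rfl
      exact hm (expo_degree n j)
  right_inv c := by
    ext j
    simp [coeff_sum, coeff_monomial, (expo_injective n).eq_iff]

/-- The identification `R_n^(d+1) ≃ k^((d+1)(n+1))` by the coefficients of the `d+1` forms. -/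
noncomputable def tupleCoeffs (k : Type*) [Field k] (d n : ℕ) :
    (Fin (d + 1) → Rdeg k n) ≃ₗ[k] (Fin (d + 1) × Fin (n + 1) → k) :=
  (LinearEquiv.piCongrRight fun _ : Fin (d + 1) => formCoeffs k n).trans
    (LinearEquiv.curry k k (Fin (d + 1)) (Fin (n + 1))).symm

theorem tupleCoeffs_apply (k : Type*) [Field k] (d n : ℕ) (a : Fin (d + 1) → Rdeg k n)
    (p : Fin (d + 1) × Fin (n + 1)) :
    tupleCoeffs k d n a p = coeff (expo n p.2) (a p.1 : R k) := rfl

/-- The polynomials `a_0, …, a_d` are relatively prime: their only common divisors in `k[s,t]`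
are units. -/
def RelPrime {k : Type*} [Field k] {d n : ℕ} (a : Fin (d + 1) → Rdeg k n) : Prop :=
  ∀ p : R k, (∀ i, p ∣ (a i : R k)) → IsUnit p

/-- `P_{n,d}`: the tuples `(a_0, …, a_d)` in `R_n^(d+1)` that are linearly independent over `k`
and relatively prime. -/
def paramSet (k : Type*) [Field k] (d n : ℕ) : Set (Fin (d + 1) → Rdeg k n) :=
  {a | LinearIndependent k a ∧ RelPrime a}

/-- The tuple `(a_0, …, a_d)` has type `μ` : there is an exact sequence of graded `R`-modules
`0 → ⨁_j R(-n-μ_j) → R(-n)^(d+1) → I → 0`, where `I` is the ideal generated by the `a_i` and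
the second map is `B = (a_0, …, a_d)`.  A graded `R`-linear map `R(-n-μ_j) → R(-n)^(d+1)` is a
column of `d+1` forms of degree `μ_j`, so the first map is a matrix `A` whose `j`-th column has
entries in `R_{μ_j}`.  Exactness at `I` is automatic, since the image of `B` is `I`. For a given
tuple there is at most one such `μ` in ascending order. -/
def HasMuType {k : Type*} [Field k] {d n : ℕ} (a : Fin (d + 1) → Rdeg k n) (μ : Fin d → ℕ) :
    Prop :=
  ∃ A : Matrix (Fin (d + 1)) (Fin d) (R k),
    (∀ i j, (A i j).IsHomogeneous (μ j)) ∧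
    Function.Injective A.mulVecLin ∧
    Function.Exact A.mulVecLin (Fintype.linearCombination (R k) fun i => (a i : R k))

/-- The image of the map `B` in the definition of the type is the ideal `⟨a_0, …, a_d⟩`. -/
theorem range_linearCombination_eq {k : Type*} [Field k] {d n : ℕ} (a : Fin (d + 1) → Rdeg k n) :
    LinearMap.range (Fintype.linearCombination (R k) fun i => (a i : R k)) =
      Ideal.span (Set.range fun i => (a i : R k)) :=
  Fintype.range_linearCombination (R k) _

/-- `μ` is a `d`-part partition of `n`: integers `1 ≤ μ_1 ≤ ⋯ ≤ μ_d` with sum `n`. -/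
structure IsPartition {d : ℕ} (μ : Fin d → ℕ) (n : ℕ) : Prop where
  pos : ∀ i, 1 ≤ μ i
  mono : Monotone μ
  sum_eq : ∑ i, μ i = n

/-- The `μ`-stratum in `R_n^(d+1)`. -/
def muStratum (k : Type*) [Field k] (d n : ℕ) (μ : Fin d → ℕ) : Set (Fin (d + 1) → Rdeg k n) :=
  {a | a ∈ paramSet k d n ∧ HasMuType a μ}

/-- The `μ`-stratum as a subset of the affine space `k^((d+1)(n+1)) ≃ R_n^(d+1)`. -/
def muStratumCoeffs (k : Type*) [Field k] (d n : ℕ) (μ : Fin d → ℕ) :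
    Set (Fin (d + 1) × Fin (n + 1) → k) :=
  tupleCoeffs k d n '' muStratum k d n μ

end MuStrata

/-! Setting `t = 1` turns forms of degree `n` into polynomials of degree at most `n`, so the work is
done over `k[X]` with degree bounds. For a tuple `a`, `syz a M` holds the syzygies with entries of
degree below `M`, and the kernel of `mulMatrix m x` is `syz a (m + 1)`, so ranks and the Hilbert
function of the syzygies determine each other.

Type `μ` forces `dim syz a M = ∑ j, max(0, M - μ j)` (`finrank_syz_of_hasMuType`). Conversely, the
resulting ranks for `m ≤ n` characterize the stratum (`mem_muStratumCoeffs_iff_rank`). The rank at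
`m = n` is then `2n + 1`: the ideal contains every form of degree `2n`. The jumps of the Hilbert
function give syzygies of degrees at most `μ j` with independent leading vectors, and the maximal
minors of their matrix are a nonzero constant times `a` (`exists_signedMinor_eq`). Minors with the
full rank condition carry the Hilbert–Burch resolution (`mem_muStratumCoeffs_of_signedMinor`). Upper
rank bounds are closed and lower ones open, so the stratum is locally closed.

Thus the stratum is the image, under the maximal minors, of an open set of matrices with column
degrees at most `μ j`. Over an infinite field this makes it irreducible; a bidiagonal matrix shows
that it is nonempty.

For the dimension, a column operation `A ↦ A * g` with constant determinant only rescales the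
minors. It brings a generic `A` to a normal form whose upper square block has the identity as matrix
of row-leading coefficients. Normal forms with one scaling parameter give a map from an affine space
with the same vanishing ideal as the stratum (`vanishingIdeal_muStratumCoeffs`), and its parameters
are rational in the coefficients of the scaled minors (`mem_range_of_slice`). So the coordinate ring
is a subalgebra of a polynomial ring that is algebraic over it, and its dimension is the number of
parameters, counted in `card_sliceIndex`. -/

namespace MuStrata

open scoped Polynomial

/-! ### Maximal minors and Cramer's rule -/

section Minors

variable {S T : Type*} [CommRing S] [CommRing T] {d : ℕ}

/-- The signed maximal minor of a `(d+1) × d` matrix obtained by deleting the row `i`. -/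
def signedMinor (A : Matrix (Fin (d + 1)) (Fin d) S) (i : Fin (d + 1)) : S :=
  (-1) ^ (i : ℕ) * (A.submatrix i.succAbove id).det

/-- Prepending a copy of column `j` gives a square matrix with two equal columns; this is the
expansion of its determinant along the new column. -/
theorem sum_signedMinor_mul (A : Matrix (Fin (d + 1)) (Fin d) S) (j : Fin d) :
    ∑ i, signedMinor A i * A i j = 0 := by
  let B : Matrix (Fin (d + 1)) (Fin (d + 1)) S := Matrix.of fun i => Fin.cons (A i j) (A i)
  have hB : B.det = 0 := by
    refine Matrix.det_zero_of_column_eq (i := 0) (j := j.succ) (Fin.succ_ne_zero j).symm ?_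
    intro i
    simp [B]
  rw [Matrix.det_succ_column B 0] at hB
  rw [← hB]
  refine Finset.sum_congr rfl fun i _ => ?_
  have h1 : B.submatrix i.succAbove (Fin.succAbove 0) = A.submatrix i.succAbove id := by
    ext a b
    simp [B]
  rw [h1]
  simp only [signedMinor, B, Matrix.of_apply, Fin.cons_zero, Fin.val_zero, add_zero]
  ring

theorem signedMinor_map (f : S →+* T) (A : Matrix (Fin (d + 1)) (Fin d) S) (i : Fin (d + 1)) :
    signedMinor (A.map f) i = f (signedMinor A i) := by
  simp only [signedMinor, map_mul, map_pow, map_neg, map_one, RingHom.map_det]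
  rfl

theorem signedMinor_mul (A : Matrix (Fin (d + 1)) (Fin d) S) (g : Matrix (Fin d) (Fin d) S)
    (i : Fin (d + 1)) : signedMinor (A * g) i = signedMinor A i * g.det := by
  have : (A * g).submatrix i.succAbove id = A.submatrix i.succAbove id * g := by
    ext a b
    simp [Matrix.mul_apply]
  rw [signedMinor, this, Matrix.det_mul, signedMinor, mul_assoc]

/-- Cramer's rule on the block without row `i` settles all other rows. Row `i` follows because both
sides are orthogonal to the vector of minors, whose `i`-th entry is nonzero. -/
theorem exists_mulVec_eq_signedMinor_smul [IsDomain S] (A : Matrix (Fin (d + 1)) (Fin d) S)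
    {v : Fin (d + 1) → S} (hv : ∑ i, signedMinor A i * v i = 0) (i : Fin (d + 1)) :
    ∃ w, A.mulVec w = signedMinor A i • v := by
  by_cases h0 : signedMinor A i = 0
  · exact ⟨0, by simp [h0]⟩
  set Ai := A.submatrix i.succAbove id with hAi
  set w := ((-1) ^ (i : ℕ)) • Ai.adjugate.mulVec (fun l => v (i.succAbove l)) with hw
  refine ⟨w, ?_⟩
  have hne : ∀ l, A.mulVec w (i.succAbove l) = signedMinor A i * v (i.succAbove l) := by
    intro l
    have h1 : A.mulVec w (i.succAbove l) = Ai.mulVec w l := rfl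
    rw [h1, hw, Matrix.mulVec_smul, Matrix.mulVec_mulVec, Matrix.mul_adjugate, signedMinor,
      Matrix.smul_mulVec, Matrix.one_mulVec]
    simp [mul_assoc, hAi]
  have horth : ∑ r, signedMinor A r * (A.mulVec w r - signedMinor A i * v r) = 0 := by
    have h1 : ∑ r, signedMinor A r * A.mulVec w r = 0 := by
      simp only [Matrix.mulVec, dotProduct, Finset.mul_sum]
      rw [Finset.sum_comm]
      refine Finset.sum_eq_zero fun j _ => ?_
      have := sum_signedMinor_mul A j
      calc _ = (∑ r, signedMinor A r * A r j) * w j := by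
            rw [Finset.sum_mul]
            exact Finset.sum_congr rfl fun r _ => by ring
        _ = 0 := by rw [this, zero_mul]
    have h2 : ∑ r, signedMinor A r * (signedMinor A i * v r) = 0 := by
      calc _ = signedMinor A i * ∑ r, signedMinor A r * v r := by
            rw [Finset.mul_sum]
            exact Finset.sum_congr rfl fun r _ => by ring
        _ = 0 := by rw [hv, mul_zero]
    simp only [mul_sub, Finset.sum_sub_distrib, h1, h2, sub_zero]
  rw [Fin.sum_univ_succAbove _ i, Finset.sum_eq_zero, add_zero] at horth
  · have hi := (mul_eq_zero.1 horth).resolve_left h0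
    ext r
    rcases Fin.eq_self_or_eq_succAbove i r with rfl | ⟨l, rfl⟩
    · simpa [sub_eq_zero] using hi
    · simpa using hne l
  · intro l _
    rw [hne, sub_self, mul_zero]

theorem exists_mulVec_eq_of_bezout [IsDomain S] (A : Matrix (Fin (d + 1)) (Fin d) S)
    {b v : Fin (d + 1) → S} (hb : ∑ i, b i * signedMinor A i = 1)
    (hv : ∑ i, signedMinor A i * v i = 0) : ∃ w, A.mulVec w = v := by
  choose w hw using exists_mulVec_eq_signedMinor_smul A hv
  refine ⟨∑ i, b i • w i, ?_⟩
  rw [Matrix.mulVec_sum]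
  simp only [Matrix.mulVec_smul, hw, smul_smul]
  rw [← Finset.sum_smul, hb, one_smul]

/-- The left kernel of a matrix of full column rank is a line, spanned by the minors. The difference
of the two sides lies in the left kernel and vanishes at `i`, so the invertible block without row
`i` kills it. -/
theorem signedMinor_mul_eq_of_vecMul_eq_zero [IsDomain S] (A : Matrix (Fin (d + 1)) (Fin d) S)
    {a : Fin (d + 1) → S} (ha : ∀ j, ∑ i, a i * A i j = 0) {i : Fin (d + 1)}
    (hi : signedMinor A i ≠ 0) (r : Fin (d + 1)) :
    signedMinor A i * a r = a i * signedMinor A r := by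
  set x : Fin (d + 1) → S := fun r => signedMinor A i * a r - a i * signedMinor A r with hx
  have hxi : x i = 0 := by simp [hx, mul_comm]
  have hxA : ∀ j, ∑ r, x r * A r j = 0 := by
    intro j
    calc _ = signedMinor A i * ∑ r, a r * A r j - a i * ∑ r, signedMinor A r * A r j := by
          rw [Finset.mul_sum, Finset.mul_sum, ← Finset.sum_sub_distrib]
          exact Finset.sum_congr rfl fun r _ => by simp only [hx]; ring
      _ = 0 := by rw [ha, sum_signedMinor_mul, mul_zero, mul_zero, sub_zero]
  have hdet : (A.submatrix i.succAbove id).det ≠ 0 := right_ne_zero_of_mul hi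
  have h0 : (fun l => x (i.succAbove l)) = 0 := by
    refine Matrix.eq_zero_of_vecMul_eq_zero hdet ?_
    ext j
    have := hxA j
    rw [Fin.sum_univ_succAbove _ i, hxi, zero_mul, zero_add] at this
    simpa [Matrix.vecMul, dotProduct] using this
  rcases Fin.eq_self_or_eq_succAbove i r with rfl | ⟨l, rfl⟩
  · ring
  · have := congrFun h0 l
    simpa [hx, sub_eq_zero] using this

end Minors

/-! ### Determinants with bounded column degrees -/

section Degrees

variable {S : Type*} [CommRing S]

theorem coeff_prod_sum_of_natDegree_le {ι : Type*} (s : Finset ι) (f : ι → S[X]) (b : ι → ℕ)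
    (h : ∀ i ∈ s, (f i).natDegree ≤ b i) :
    (∏ i ∈ s, f i).coeff (∑ i ∈ s, b i) = ∏ i ∈ s, (f i).coeff (b i) := by
  classical
  induction s using Finset.induction_on with
  | empty => simp
  | insert a s ha ih =>
    have h' : ∀ i ∈ s, (f i).natDegree ≤ b i := fun i hi => h i (Finset.mem_insert_of_mem hi)
    rw [Finset.prod_insert ha, Finset.sum_insert ha, Finset.prod_insert ha, ← ih h']
    exact Polynomial.coeff_mul_add_eq_of_natDegree_le (h a (Finset.mem_insert_self _ _))
      ((Polynomial.natDegree_prod_le _ _).trans (Finset.sum_le_sum h'))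

variable {d : ℕ} {b : Fin d → ℕ}

theorem natDegree_det_le {M : Matrix (Fin d) (Fin d) S[X]} (h : ∀ i j, (M i j).natDegree ≤ b j) :
    M.det.natDegree ≤ ∑ j, b j := by
  rw [Matrix.det_apply]
  refine Polynomial.natDegree_sum_le_of_forall_le _ _ fun σ _ => ?_
  refine (Polynomial.natDegree_smul_le _ _).trans ?_
  exact (Polynomial.natDegree_prod_le _ _).trans (Finset.sum_le_sum fun j _ => h _ _)

/-- Each Leibniz term takes one factor from every column, so its top possible coefficient is the
product of the top coefficients. -/
theorem coeff_det_sum {M : Matrix (Fin d) (Fin d) S[X]} (h : ∀ i j, (M i j).natDegree ≤ b j) :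
    M.det.coeff (∑ j, b j) = (Matrix.of fun i j => (M i j).coeff (b j)).det := by
  rw [Matrix.det_apply, Matrix.det_apply, Polynomial.finsetSum_coeff]
  refine Finset.sum_congr rfl fun σ _ => ?_
  rw [Polynomial.coeff_smul, coeff_prod_sum_of_natDegree_le _ _ _ fun j _ => h _ _]
  rfl

variable {A : Matrix (Fin (d + 1)) (Fin d) S[X]}

theorem neg_one_pow_eq_C (i : ℕ) : ((-1) ^ i : S[X]) = Polynomial.C ((-1) ^ i) := by simp

theorem natDegree_signedMinor_le (h : ∀ i j, (A i j).natDegree ≤ b j) (i : Fin (d + 1)) :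
    (signedMinor A i).natDegree ≤ ∑ j, b j := by
  rw [signedMinor, neg_one_pow_eq_C]
  exact (Polynomial.natDegree_C_mul_le _ _).trans
    (natDegree_det_le (M := A.submatrix i.succAbove id) fun _ _ => h _ _)

theorem coeff_signedMinor_sum (h : ∀ i j, (A i j).natDegree ≤ b j) (i : Fin (d + 1)) :
    (signedMinor A i).coeff (∑ j, b j) =
      signedMinor (Matrix.of fun i j => (A i j).coeff (b j)) i := by
  rw [signedMinor, neg_one_pow_eq_C, Polynomial.coeff_C_mul,
    coeff_det_sum (b := b) (M := A.submatrix i.succAbove id) fun _ _ => h _ _]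
  rfl

end Degrees

/-! ### Coefficient vectors of polynomials of bounded degree -/

section Forms

variable {S T : Type*} [CommRing S] [CommRing T] {M : ℕ}

/-- The polynomial of degree less than `M` with prescribed coefficients. -/
noncomputable def ofCoeffs : (Fin M → S) →ₗ[S] S[X] :=
  ∑ l : Fin M, (Polynomial.monomial (l : ℕ)).comp (LinearMap.proj l)

theorem ofCoeffs_apply (x : Fin M → S) :
    ofCoeffs x = ∑ l : Fin M, Polynomial.monomial (l : ℕ) (x l) := by
  simp [ofCoeffs]

theorem coeff_ofCoeffs (x : Fin M → S) (l : ℕ) :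
    (ofCoeffs x).coeff l = if h : l < M then x ⟨l, h⟩ else 0 := by
  rw [ofCoeffs_apply, Polynomial.finsetSum_coeff]
  simp only [Polynomial.coeff_monomial]
  split_ifs with h
  · rw [Finset.sum_eq_single ⟨l, h⟩]
    · simp
    · intro b _ hb
      rw [if_neg]
      rintro rfl
      exact hb rfl
    · simp
  · refine Finset.sum_eq_zero fun b _ => if_neg ?_
    rintro rfl
    exact h b.2

theorem coeff_ofCoeffs_fin (x : Fin M → S) (l : Fin M) : (ofCoeffs x).coeff l = x l := by
  rw [coeff_ofCoeffs, dif_pos l.2]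

theorem mem_degreeLT_iff_coeff {p : S[X]} :
    p ∈ Polynomial.degreeLT S M ↔ ∀ l, M ≤ l → p.coeff l = 0 := by
  rw [Polynomial.mem_degreeLT, Polynomial.degree_lt_iff_coeff_zero]

theorem mem_degreeLT_succ_iff {p : S[X]} :
    p ∈ Polynomial.degreeLT S (M + 1) ↔ p.natDegree ≤ M := by
  rw [mem_degreeLT_iff_coeff, Polynomial.natDegree_le_iff_coeff_eq_zero]
  exact Iff.rfl

theorem ofCoeffs_mem_degreeLT (x : Fin M → S) : ofCoeffs x ∈ Polynomial.degreeLT S M := by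
  rw [mem_degreeLT_iff_coeff]
  intro l hl
  rw [coeff_ofCoeffs, dif_neg (by omega)]

theorem natDegree_ofCoeffs_le (x : Fin (M + 1) → S) : (ofCoeffs x).natDegree ≤ M :=
  mem_degreeLT_succ_iff.1 (ofCoeffs_mem_degreeLT x)

theorem ofCoeffs_coeff {p : S[X]} (hp : p ∈ Polynomial.degreeLT S M) :
    ofCoeffs (fun l : Fin M => p.coeff l) = p := by
  ext l
  rw [coeff_ofCoeffs]
  split_ifs with h
  · rfl
  · exact (mem_degreeLT_iff_coeff.1 hp l (by omega)).symm

theorem ofCoeffs_injective : Function.Injective (ofCoeffs : (Fin M → S) → S[X]) := by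
  intro x y h
  ext l
  rw [← coeff_ofCoeffs_fin x, h, coeff_ofCoeffs_fin]

theorem map_ofCoeffs (f : S →+* T) (x : Fin M → S) :
    (ofCoeffs x).map f = ofCoeffs (fun l => f (x l)) := by
  simp [ofCoeffs_apply, Polynomial.map_sum]

end Forms

/-! ### Bounded syzygies and multiplication matrices -/

section Tuples

variable {S T : Type*} [CommRing S] [CommRing T] {d M n m : ℕ}

/-- The tuple of `d + 1` polynomials of degree less than `M` with prescribed coefficients. -/
noncomputable def tuple : (Fin (d + 1) × Fin M → S) →ₗ[S] (Fin (d + 1) → S[X]) :=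
  LinearMap.pi fun i => ofCoeffs.comp (LinearMap.funLeft S S fun l => (i, l))

theorem tuple_apply (x : Fin (d + 1) × Fin M → S) (i : Fin (d + 1)) :
    tuple x i = ofCoeffs fun l => x (i, l) := rfl

theorem tuple_injective :
    Function.Injective (tuple : (Fin (d + 1) × Fin M → S) → Fin (d + 1) → S[X]) := by
  intro x y h
  ext ⟨i, l⟩
  exact congrFun (ofCoeffs_injective (congrFun h i)) l

theorem map_tuple (f : S →+* T) (x : Fin (d + 1) × Fin M → S) (i : Fin (d + 1)) :
    (tuple x i).map f = tuple (fun p => f (x p)) i := map_ofCoeffs f _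

theorem tuple_coeff {v : Fin (d + 1) → S[X]} (hv : ∀ i, v i ∈ Polynomial.degreeLT S M) :
    tuple (fun p : Fin (d + 1) × Fin M => (v p.1).coeff p.2) = v :=
  funext fun i => ofCoeffs_coeff (hv i)

/-- The syzygies of `a` with entries of degree less than `M`. -/
noncomputable def syz (a : Fin (d + 1) → S[X]) (M : ℕ) : Submodule S (Fin (d + 1) → S[X]) :=
  (Submodule.pi Set.univ fun _ => Polynomial.degreeLT S M) ⊓
    LinearMap.ker ((Fintype.linearCombination S[X] a).restrictScalars S)

theorem mem_syz {a : Fin (d + 1) → S[X]} {v : Fin (d + 1) → S[X]} :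
    v ∈ syz a M ↔ (∀ i, v i ∈ Polynomial.degreeLT S M) ∧ ∑ i, v i * a i = 0 := by
  simp [syz, Submodule.mem_pi, Fintype.linearCombination_apply]

/-- The matrix of the map `b ↦ ∑ i, b i * a i`, where the `a i` have degree at most `n` and the
`b i` have degree at most `m`. -/
noncomputable def mulMatrix (m : ℕ) (x : Fin (d + 1) × Fin (n + 1) → S) :
    Matrix (Fin (n + m + 1)) (Fin (d + 1) × Fin (m + 1)) S :=
  Matrix.of fun r p => (tuple x p.1 * Polynomial.X ^ (p.2 : ℕ)).coeff r

theorem map_mulMatrix (f : S →+* T) (x : Fin (d + 1) × Fin (n + 1) → S) :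
    (mulMatrix m x).map f = mulMatrix m (fun p => f (x p)) := by
  ext r p
  simp only [mulMatrix, Matrix.map_apply, Matrix.of_apply, ← map_tuple]
  rw [← Polynomial.coeff_map]
  simp

theorem mulMatrix_mulVec (x : Fin (d + 1) × Fin (n + 1) → S) (v : Fin (d + 1) × Fin (m + 1) → S)
    (r : Fin (n + m + 1)) :
    (mulMatrix m x).mulVec v r = (∑ i, tuple v i * tuple x i).coeff r := by
  rw [Polynomial.finsetSum_coeff, Matrix.mulVec, dotProduct, Fintype.sum_prod_type]
  refine Finset.sum_congr rfl fun i _ => ?_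
  rw [tuple_apply v, ofCoeffs_apply, Finset.sum_mul, Polynomial.finsetSum_coeff]
  refine Finset.sum_congr rfl fun l _ => ?_
  rw [← Polynomial.C_mul_X_pow_eq_monomial, mul_assoc, Polynomial.coeff_C_mul, mul_comm,
    mulMatrix, Matrix.of_apply, mul_comm (tuple x i)]

theorem natDegree_sum_mul_le {a b : Fin (d + 1) → S[X]} (ha : ∀ i, (a i).natDegree ≤ n)
    (hb : ∀ i, (b i).natDegree ≤ m) : (∑ i, b i * a i).natDegree ≤ n + m :=
  Polynomial.natDegree_sum_le_of_forall_le _ _ fun i _ => by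
    rw [add_comm]
    exact Polynomial.natDegree_mul_le_of_le (hb i) (ha i)

theorem natDegree_tuple_le (x : Fin (d + 1) × Fin (n + 1) → S) (i : Fin (d + 1)) :
    (tuple x i).natDegree ≤ n := natDegree_ofCoeffs_le _

theorem mulMatrix_mulVec_eq_zero_iff (x : Fin (d + 1) × Fin (n + 1) → S)
    (v : Fin (d + 1) × Fin (m + 1) → S) :
    (mulMatrix m x).mulVec v = 0 ↔ ∑ i, tuple v i * tuple x i = 0 := by
  constructor
  · intro h
    ext r
    by_cases hr : r < n + m + 1
    · have := congrFun h ⟨r, hr⟩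
      rwa [mulMatrix_mulVec] at this
    · exact Polynomial.coeff_eq_zero_of_natDegree_lt
        ((natDegree_sum_mul_le (natDegree_tuple_le x) (natDegree_tuple_le v)).trans_lt (by omega))
  · intro h
    ext r
    rw [mulMatrix_mulVec, h]
    simp

theorem map_ker_mulMatrix (x : Fin (d + 1) × Fin (n + 1) → S) :
    (LinearMap.ker (mulMatrix m x).mulVecLin).map tuple = syz (tuple x) (m + 1) := by
  ext v
  constructor
  · rintro ⟨u, hu, rfl⟩
    exact mem_syz.2 ⟨fun i => ofCoeffs_mem_degreeLT _, (mulMatrix_mulVec_eq_zero_iff x u).1 hu⟩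
  · intro hv
    rw [mem_syz] at hv
    refine ⟨_, ?_, tuple_coeff hv.1⟩
    change (mulMatrix m x).mulVec _ = 0
    rw [mulMatrix_mulVec_eq_zero_iff, tuple_coeff hv.1]
    exact hv.2

end Tuples

/-! ### Consequences of full rank -/

section Rank

variable {F : Type*} [Field F] {d n m : ℕ}

theorem rank_add_finrank_syz (x : Fin (d + 1) × Fin (n + 1) → F) :
    (mulMatrix m x).rank + Module.finrank F (syz (tuple x) (m + 1)) = (d + 1) * (m + 1) := by
  rw [← map_ker_mulMatrix, ← (Submodule.equivMapOfInjective tuple tuple_injective _).finrank_eq,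
    Matrix.rank, LinearMap.finrank_range_add_finrank_ker]
  simp

theorem rank_mulMatrix_eq_iff (x : Fin (d + 1) × Fin (n + 1) → F) :
    (mulMatrix m x).rank = n + m + 1 ↔ ∀ r ≤ n + m, ∃ b : Fin (d + 1) → F[X],
      (∀ i, (b i).natDegree ≤ m) ∧ ∑ i, b i * tuple x i = Polynomial.X ^ r := by
  have key : (mulMatrix m x).rank = n + m + 1 ↔
      LinearMap.range (mulMatrix m x).mulVecLin = ⊤ := by
    constructor
    · intro h
      apply Submodule.eq_top_of_finrank_eq
      rw [Module.finrank_fin_fun]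
      exact h
    · intro h
      rw [Matrix.rank, h, finrank_top, Module.finrank_fin_fun]
  rw [key]
  constructor
  · intro h r hr
    obtain ⟨v, hv⟩ : (Pi.single ⟨r, by omega⟩ 1 : Fin (n + m + 1) → F) ∈
      LinearMap.range (mulMatrix m x).mulVecLin := h ▸ Submodule.mem_top
    refine ⟨tuple v, natDegree_tuple_le v, ?_⟩
    ext l
    rw [Polynomial.coeff_X_pow]
    by_cases hl : l < n + m + 1
    · have := congrFun hv ⟨l, hl⟩
      rw [Matrix.mulVecLin_apply, mulMatrix_mulVec] at this
      rw [this, Pi.single_apply]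
      simp
    · rw [if_neg (by omega)]
      exact Polynomial.coeff_eq_zero_of_natDegree_lt
        ((natDegree_sum_mul_le (natDegree_tuple_le x) (natDegree_tuple_le v)).trans_lt (by omega))
  · intro h
    rw [eq_top_iff, ← (Pi.basisFun F (Fin (n + m + 1))).span_eq, Submodule.span_le]
    rintro _ ⟨r, rfl⟩
    obtain ⟨b, hb, hbr⟩ := h r (by omega)
    refine ⟨fun p => (b p.1).coeff p.2, ?_⟩
    ext l
    rw [Matrix.mulVecLin_apply, mulMatrix_mulVec, tuple_coeff fun i => mem_degreeLT_succ_iff.2 (hb i),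
      hbr, Polynomial.coeff_X_pow, Pi.basisFun_apply, Pi.single_apply]
    simp [Fin.ext_iff]

theorem exists_bezout_of_rank {x : Fin (d + 1) × Fin (n + 1) → F}
    (h : (mulMatrix m x).rank = n + m + 1) : ∃ b : Fin (d + 1) → F[X], ∑ i, b i * tuple x i = 1 := by
  obtain ⟨b, -, hb⟩ := (rank_mulMatrix_eq_iff x).1 h 0 (by omega)
  exact ⟨b, by simpa using hb⟩

/-- This says that there is no common zero at infinity: without a term in `X ^ n`, no combination
could reach `X ^ (n + m)`. -/
theorem exists_coeff_ne_zero_of_rank {x : Fin (d + 1) × Fin (n + 1) → F}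
    (h : (mulMatrix m x).rank = n + m + 1) : ∃ i, (tuple x i).coeff n ≠ 0 := by
  obtain ⟨b, hb, hbr⟩ := (rank_mulMatrix_eq_iff x).1 h (n + m) le_rfl
  by_contra! h0
  have h1 := congrArg (fun p => p.coeff (m + n)) hbr
  simp only [Polynomial.finsetSum_coeff] at h1
  rw [Finset.sum_eq_zero] at h1
  · simp [add_comm] at h1
  · intro i _
    rw [Polynomial.coeff_mul_add_eq_of_natDegree_le (hb i) (natDegree_tuple_le x i), h0, mul_zero]

end Rank

/-! ### Passage between forms and polynomials -/

section Dehomogenization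

variable {k : Type*} [Field k] {n m d : ℕ}

/-- The dehomogenization `s ↦ X`, `t ↦ 1`. -/
noncomputable def dehom : R k →ₐ[k] k[X] := aeval ![Polynomial.X, 1]

theorem dehom_homogenize {p : k[X]} (hp : p.natDegree ≤ n) : dehom (p.homogenize n) = p :=
  Polynomial.aeval_homogenize_X_one p hp

theorem homogenize_dehom {q : R k} (hq : q.IsHomogeneous n) : (dehom q).homogenize n = q :=
  Polynomial.homogenize_eq_of_isHomogeneous hq rfl

theorem eq_zero_of_dehom_eq_zero {q : R k} (hq : q.IsHomogeneous n) (h : dehom q = 0) : q = 0 := by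
  rw [← homogenize_dehom hq, h, Polynomial.homogenize_zero]

theorem eq_of_dehom_eq {p q : R k} (hp : p.IsHomogeneous n) (hq : q.IsHomogeneous n)
    (h : dehom p = dehom q) : p = q := by
  rw [← homogenize_dehom hp, h, homogenize_dehom hq]

theorem natDegree_dehom_le {q : R k} (hq : q.IsHomogeneous n) : (dehom q).natDegree ≤ n := by
  rw [q.as_sum, map_sum]
  refine Polynomial.natDegree_sum_le_of_forall_le _ _ fun e he => ?_
  have h2 : e.degree = n := by
    by_contra hne
    exact (mem_support_iff.1 he) (hq.coeff_eq_zero hne)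
  rw [Finsupp.degree_eq_sum, Fin.sum_univ_two] at h2
  rw [dehom, aeval_monomial, Finsupp.prod_fintype _ _ (by simp), Fin.prod_univ_two]
  simp only [Matrix.cons_val_zero, Matrix.cons_val_one, one_pow, mul_one]
  rw [← Polynomial.C_eq_algebraMap]
  exact (Polynomial.natDegree_C_mul_X_pow_le _ _).trans (by omega)

theorem coeff_expo_eq {q : R k} (hq : q.IsHomogeneous n) (j : Fin (n + 1)) :
    coeff (expo n j) q = (dehom q).coeff j := by
  rw [← homogenize_dehom hq, Polynomial.coeff_homogenize, homogenize_dehom hq, if_pos]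
  · simp [expo]
  · have := j.2
    simp [expo]
    omega

theorem tuple_tupleCoeffs (a : Fin (d + 1) → Rdeg k n) (i : Fin (d + 1)) :
    tuple (tupleCoeffs k d n a) i = dehom (a i : R k) := by
  rw [tuple_apply]
  simp only [tupleCoeffs_apply, coeff_expo_eq (a i).2]
  exact ofCoeffs_coeff (mem_degreeLT_succ_iff.2 (natDegree_dehom_le (a i).2))

theorem coe_eq_homogenize (x : Fin (d + 1) × Fin (n + 1) → k) (i : Fin (d + 1)) :
    (((tupleCoeffs k d n).symm x i : Rdeg k n) : R k) = (tuple x i).homogenize n := by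
  have := tuple_tupleCoeffs ((tupleCoeffs k d n).symm x) i
  rw [LinearEquiv.apply_symm_apply] at this
  rw [this, homogenize_dehom ((tupleCoeffs k d n).symm x i).2]

theorem homogeneousComponent_mul_of_le {σ : Type*} {A W : MvPolynomial σ k} {e : ℕ}
    (hA : A.IsHomogeneous e) (he : e ≤ m) :
    homogeneousComponent m (A * W) = A * homogeneousComponent (m - e) W := by
  conv_lhs => rw [← sum_homogeneousComponent W, Finset.mul_sum, map_sum]
  have hterm : ∀ i, homogeneousComponent m (A * homogeneousComponent i W) =
      if i = m - e then A * homogeneousComponent i W else 0 := by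
    intro i
    have h := hA.mul (homogeneousComponent_isHomogeneous i W)
    rw [homogeneousComponent_of_mem ((mem_homogeneousSubmodule _ _).2 h)]
    exact if_congr (by omega) rfl rfl
  rw [Finset.sum_congr rfl fun i _ => hterm i, Finset.sum_ite_eq']
  split_ifs with h
  · rfl
  · have h0 : homogeneousComponent (m - e) W = 0 := by
      apply homogeneousComponent_eq_zero
      rw [Finset.mem_range] at h
      omega
    rw [h0, mul_zero]

theorem homogeneousComponent_mul_of_lt {σ : Type*} {A W : MvPolynomial σ k} {e : ℕ}
    (hA : A.IsHomogeneous e) (he : m < e) : homogeneousComponent m (A * W) = 0 := by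
  conv_lhs => rw [← sum_homogeneousComponent W, Finset.mul_sum, map_sum]
  refine Finset.sum_eq_zero fun i _ => ?_
  rw [homogeneousComponent_of_mem ((mem_homogeneousSubmodule _ _).2
    (hA.mul (homogeneousComponent_isHomogeneous i W))), if_neg (by omega)]

end Dehomogenization

/-! ### Hilbert function of the syzygies -/

section Hilbert

variable {k : Type*} [Field k] {n d : ℕ} {μ : Fin d → ℕ}

theorem natDegree_mul_le_of_mem {A : k[X]} {u : k[X]} {e M : ℕ} (hA : A.natDegree ≤ e)
    (hu : u ∈ Polynomial.degreeLT k (M - e)) : A * u ∈ Polynomial.degreeLT k M := by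
  by_cases h : u = 0
  · simp [h]
  · rw [Polynomial.mem_degreeLT, Polynomial.degree_eq_natDegree h, Nat.cast_lt] at hu
    obtain ⟨M, rfl⟩ : ∃ M', M = M' + 1 := ⟨M - 1, by omega⟩
    rw [mem_degreeLT_succ_iff]
    exact (Polynomial.natDegree_mul_le_of_le hA le_rfl).trans (by omega)

theorem finrank_pi_degreeLT {F : Type*} [Field F] (e : Fin d → ℕ) :
    Module.finrank F (∀ j, Polynomial.degreeLT F (e j)) = ∑ j, e j := by
  have e' := LinearEquiv.piCongrRight fun j => Polynomial.degreeLTEquiv F (e j)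
  rw [e'.finrank_eq, Module.finrank_pi_fintype]
  simp

/-- The Hilbert function of the syzygies of a tuple of type `μ`. -/
theorem finrank_syz_of_hasMuType {a : Fin (d + 1) → Rdeg k n} (ha : HasMuType a μ) (M : ℕ) :
    Module.finrank k (syz (fun i => dehom (a i : R k)) M) = ∑ j, (M - μ j) := by
  obtain ⟨A, hA, hinj, hex⟩ := ha
  have hexact : ∀ v : Fin (d + 1) → R k, ∑ i, v i * (a i : R k) = 0 ↔ ∃ w, A.mulVec w = v := by
    intro v
    have := hex v
    simpa [Fintype.linearCombination_apply] using this
  set A' : Matrix (Fin (d + 1)) (Fin d) k[X] := A.map dehom with hA'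
  have hdeg : ∀ i j, (A' i j).natDegree ≤ μ j := fun i j => natDegree_dehom_le (hA i j)
  have hmap : ∀ w : Fin d → R k, (fun i => dehom (A.mulVec w i)) =
      A'.mulVec (fun j => dehom (w j)) := by
    intro w
    ext1 i
    simp [Matrix.mulVec, dotProduct, hA', map_sum]
  -- The resolution in a single degree: `f` will be an isomorphism onto `syz`. Truncated subtraction
  -- makes the `j`-th factor zero when `M ≤ μ j`.
  let f : (∀ j, Polynomial.degreeLT k (M - μ j)) →ₗ[k] (Fin (d + 1) → k[X]) :=
    (A'.mulVecLin.restrictScalars k).comp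
      (LinearMap.pi fun j => (Submodule.subtype _).comp (LinearMap.proj j))
  have hf : ∀ u, f u = A'.mulVec fun j => (u j : k[X]) := fun u => rfl
  have hfi : Function.Injective f := by
    rw [injective_iff_map_eq_zero]
    intro u hu
    rw [hf] at hu
    -- Homogenizing `u j` to degree `M - 1 - μ j` puts all of `A W` in degree `M - 1`, so
    -- injectivity over `k[s,t]` applies.
    set W : Fin d → R k := fun j => if μ j < M then
      (u j : k[X]).homogenize (M - 1 - μ j) else 0 with hW
    have hdW : ∀ j, dehom (W j) = (u j : k[X]) := by
      intro j
      have hj := mem_degreeLT_iff_coeff.1 (u j).2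
      by_cases h : μ j < M
      · simp only [hW, if_pos h]
        refine dehom_homogenize (Polynomial.natDegree_le_iff_coeff_eq_zero.2 fun l hl => hj l ?_)
        omega
      · have : (u j : k[X]) = 0 := by
          ext l
          exact hj l (by omega)
        simp only [hW, if_neg h, map_zero, this]
    have hAW : A.mulVec W = 0 := by
      ext1 i
      refine eq_zero_of_dehom_eq_zero (n := M - 1) ?_ ?_
      · refine IsHomogeneous.sum _ _ _ fun j _ => ?_
        by_cases h : μ j < M
        · simp only [hW, if_pos h]
          have := (hA i j).mul (Polynomial.isHomogeneous_homogenize (n := M - 1 - μ j) (u j : k[X]))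
          rwa [show μ j + (M - 1 - μ j) = M - 1 by omega] at this
        · simp only [hW, if_neg h, mul_zero]
          exact isHomogeneous_zero _ _ _
      · have := congrFun (hmap W) i
        simp only [hdW, hu] at this
        exact this
    have hW0 : W = 0 := hinj (by simpa using hAW)
    ext1 j
    apply Subtype.ext
    rw [← hdW, hW0]
    simp
  have hrange : LinearMap.range f = syz (fun i => dehom (a i : R k)) M := by
    apply le_antisymm
    · rintro _ ⟨u, rfl⟩
      rw [mem_syz, hf]
      refine ⟨fun i => ?_, ?_⟩
      · change (∑ j, A' i j * (u j : k[X])) ∈ _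
        exact Submodule.sum_mem _ fun j _ => natDegree_mul_le_of_mem (hdeg i j) (u j).2
      have h0 : ∀ j, ∑ i, A i j * (a i : R k) = 0 := by
        intro j
        refine (hexact _).2 ⟨Pi.single j 1, ?_⟩
        ext1 i
        simp
      have h1 : ∀ j, ∑ i, A' i j * dehom (a i : R k) = 0 := by
        intro j
        have := congrArg dehom (h0 j)
        rw [map_sum, map_zero] at this
        rw [← this]
        exact Finset.sum_congr rfl fun i _ => (map_mul _ _ _).symm
      simp only [Matrix.mulVec, dotProduct, Finset.sum_mul]
      rw [Finset.sum_comm]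
      refine Finset.sum_eq_zero fun j _ => ?_
      calc _ = (∑ i, A' i j * dehom (a i : R k)) * (u j : k[X]) := by
            rw [Finset.sum_mul]
            exact Finset.sum_congr rfl fun i _ => by ring
        _ = 0 := by rw [h1, zero_mul]
    · intro v hv
      rw [mem_syz] at hv
      obtain ⟨hvd, hv0⟩ := hv
      cases M with
      | zero =>
        have : v = 0 := by
          ext1 i
          have := hvd i
          rw [Polynomial.mem_degreeLT] at this
          simpa using this
        rw [this]
        exact Submodule.zero_mem _
      | succ m =>
        have hvd' : ∀ i, (v i).natDegree ≤ m := fun i => mem_degreeLT_succ_iff.1 (hvd i)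
        set V : Fin (d + 1) → R k := fun i => (v i).homogenize m with hV
        have hVh : ∀ i, (V i).IsHomogeneous m := fun i => Polynomial.isHomogeneous_homogenize _
        have hV0 : ∑ i, V i * (a i : R k) = 0 := by
          refine eq_zero_of_dehom_eq_zero (n := m + n)
            (IsHomogeneous.sum _ _ _ fun i _ => (hVh i).mul (a i).2) ?_
          rw [map_sum, ← hv0]
          refine Finset.sum_congr rfl fun i _ => ?_
          rw [map_mul, hV, dehom_homogenize (hvd' i)]
        obtain ⟨W, hW⟩ := (hexact V).1 hV0
        -- A preimage of a vector of forms of degree `m` may be replaced by its components of degree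
        -- `m - μ j`, the only ones that contribute to degree `m`.
        set W' : Fin d → R k := fun j =>
          if μ j ≤ m then homogeneousComponent (m - μ j) (W j) else 0 with hW'
        have hAW' : A.mulVec W' = V := by
          ext1 i
          have h1 : homogeneousComponent m (V i) = V i := by
            rw [homogeneousComponent_of_mem ((mem_homogeneousSubmodule _ _).2 (hVh i)), if_pos rfl]
          rw [← h1, ← hW, Matrix.mulVec, Matrix.mulVec, dotProduct, dotProduct, map_sum]
          refine Finset.sum_congr rfl fun j _ => ?_
          by_cases h : μ j ≤ m
          · rw [homogeneousComponent_mul_of_le (hA i j) h]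
            simp only [hW', if_pos h]
          · rw [homogeneousComponent_mul_of_lt (hA i j) (by omega)]
            simp only [hW', if_neg h, mul_zero]
        have hmem : ∀ j, dehom (W' j) ∈ Polynomial.degreeLT k (m + 1 - μ j) := by
          intro j
          by_cases h : μ j ≤ m
          · rw [show m + 1 - μ j = m - μ j + 1 by omega, mem_degreeLT_succ_iff]
            simp only [hW', if_pos h]
            exact natDegree_dehom_le (homogeneousComponent_isHomogeneous _ _)
          · simp only [hW', if_neg h, map_zero, Submodule.zero_mem]
        refine ⟨fun j => ⟨_, hmem j⟩, ?_⟩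
        rw [hf]
        have := hmap W'
        rw [hAW'] at this
        rw [← this]
        ext1 i
        exact dehom_homogenize (hvd' i)
  rw [← hrange, ← (LinearEquiv.ofInjective f hfi).finrank_eq, finrank_pi_degreeLT]

end Hilbert

/-! ### Hilbert–Burch: minors of full rank lie in the stratum -/

section Stratum

variable {k : Type*} [Field k] {n d : ℕ} {μ : Fin d → ℕ}

theorem homogenize_sum_mul {b a : Fin (d + 1) → k[X]} {m : ℕ} (hb : ∀ i, (b i).natDegree ≤ m)
    (ha : ∀ i, (a i).natDegree ≤ n) :
    (∑ i, b i * a i).homogenize (m + n) = ∑ i, (b i).homogenize m * (a i).homogenize n := by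
  rw [Polynomial.homogenize_finsetSum]
  exact Finset.sum_congr rfl fun i _ => Polynomial.homogenize_mul _ _ (hb i) (ha i)

/-- Full rank puts powers of both `s` and `t` into the ideal. These are coprime, which gives
relative primality and lets Cramer's rule, valid only up to a factor from the ideal, be sharpened to
exactness. -/
theorem mem_muStratumCoeffs_of_signedMinor (hμ : IsPartition μ n)
    {A : Matrix (Fin (d + 1)) (Fin d) k[X]} (hA : ∀ i j, (A i j).natDegree ≤ μ j)
    {x : Fin (d + 1) × Fin (n + 1) → k} (hx : ∀ i, tuple x i = signedMinor A i)
    (hr : (mulMatrix n x).rank = n + n + 1) : x ∈ muStratumCoeffs k d n μ := by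
  set a := (tupleCoeffs k d n).symm x with ha
  have haR : ∀ i, (a i : R k) = (tuple x i).homogenize n := coe_eq_homogenize x
  set B : Matrix (Fin (d + 1)) (Fin d) (R k) :=
    Matrix.of fun i j => (A i j).homogenize (μ j) with hB
  have hBh : ∀ i j, (B i j).IsHomogeneous (μ j) := fun i j =>
    Polynomial.isHomogeneous_homogenize _
  have hBA : B.map dehom = A := by
    ext1 i j
    exact dehom_homogenize (hA i j)
  have hdetB : ∀ i, signedMinor B i = (a i : R k) := by
    intro i
    refine eq_of_dehom_eq (n := n) ?_ (a i).2 ?_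
    · have h1 : ((B.submatrix i.succAbove id).det).IsHomogeneous n := by
        rw [Matrix.det_apply, ← hμ.sum_eq]
        refine IsHomogeneous.sum _ _ _ fun σ _ => ?_
        have := IsHomogeneous.prod Finset.univ (fun j => (B.submatrix i.succAbove id) (σ j) j) μ
          fun j _ => hBh _ _
        rcases Int.units_eq_one_or (Equiv.Perm.sign σ) with h | h
        · rw [h, one_smul]
          exact this
        · rw [h, Units.neg_smul, one_smul]
          exact this.neg
      rcases neg_one_pow_eq_or (R k) (i : ℕ) with h | h
      · rw [signedMinor, h, one_mul]
        exact h1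
      · rw [signedMinor, h, neg_one_mul]
        exact h1.neg
    · have h1 := signedMinor_map (dehom (k := k) : R k →+* k[X]) B i
      have h2 : B.map (dehom (k := k) : R k →+* k[X]) = A := hBA
      rw [h2] at h1
      rw [haR, dehom_homogenize (natDegree_tuple_le x i), hx, h1]
      rfl
  have hbez : ∀ r ≤ n + n, ∃ b : Fin (d + 1) → R k,
      ∑ i, b i * (a i : R k) = X 0 ^ r * X 1 ^ (n + n - r) := by
    intro r hr'
    obtain ⟨b, hb, hbr⟩ := (rank_mulMatrix_eq_iff x).1 hr r hr'
    refine ⟨fun i => (b i).homogenize n, ?_⟩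
    simp only [haR]
    rw [← homogenize_sum_mul hb (natDegree_tuple_le x), hbr, Polynomial.homogenize_X_pow hr']
  obtain ⟨b0, hb0⟩ := hbez 0 (by omega)
  obtain ⟨b1, hb1⟩ := hbez (n + n) le_rfl
  simp only [pow_zero, one_mul, Nat.sub_zero] at hb0
  simp only [Nat.sub_self, pow_zero, mul_one] at hb1
  have hst : IsRelPrime ((X 0 : R k) ^ (n + n)) (X 1 ^ (n + n)) := by
    refine IsRelPrime.pow ?_
    rw [(X_prime (R := k) (i := (0 : Fin 2))).irreducible.isRelPrime_iff_not_dvd]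
    rw [X_dvd_X]
    decide
  have hrel : RelPrime a := by
    intro p hp
    refine hst ?_ ?_
    · rw [← hb1]
      exact Finset.dvd_sum fun i _ => (hp i).mul_left _
    · rw [← hb0]
      exact Finset.dvd_sum fun i _ => (hp i).mul_left _
  have hinj : Function.Injective B.mulVecLin := by
    obtain ⟨i, hi⟩ : ∃ i, (a i : R k) ≠ 0 := by
      by_contra! h
      simp only [h, mul_zero, Finset.sum_const_zero] at hb0
      exact pow_ne_zero _ (X_ne_zero 1) hb0.symm
    rw [← hdetB] at hi
    have hdet : (B.submatrix i.succAbove id).det ≠ 0 := right_ne_zero_of_mul hi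
    rw [injective_iff_map_eq_zero]
    intro w hw
    refine Matrix.eq_zero_of_mulVec_eq_zero hdet ?_
    ext1 l
    exact congrFun hw (i.succAbove l)
  have hexact : ∀ v : Fin (d + 1) → R k, ∑ i, v i * (a i : R k) = 0 ↔ ∃ w, B.mulVec w = v := by
    intro v
    constructor
    · intro hv
      have hv' : ∑ i, signedMinor B i * v i = 0 := by
        rw [← hv]
        exact Finset.sum_congr rfl fun i _ => by rw [hdetB, mul_comm]
      choose w hw using exists_mulVec_eq_signedMinor_smul B hv'
      have hcomb : ∀ b : Fin (d + 1) → R k,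
          B.mulVec (∑ i, b i • w i) = (∑ i, b i * (a i : R k)) • v := by
        intro b
        rw [Matrix.mulVec_sum, Finset.sum_smul]
        refine Finset.sum_congr rfl fun i _ => ?_
        rw [Matrix.mulVec_smul, hw, hdetB, smul_smul]
      have h0 := hcomb b0
      have h1 := hcomb b1
      rw [hb0] at h0
      rw [hb1] at h1
      set w0 := ∑ i, b0 i • w i
      set w1 := ∑ i, b1 i • w i
      -- `B` sends `w0` to `t^(2n) v` and `w1` to `s^(2n) v`, so both sides have the same image.
      -- Hence `t^(2n)` divides `w0`, and the quotient is a preimage of `v`.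
      have heq : (X 0 : R k) ^ (n + n) • w0 = (X 1 : R k) ^ (n + n) • w1 := by
        apply hinj
        rw [Matrix.mulVecLin_apply, Matrix.mulVecLin_apply, Matrix.mulVec_smul, Matrix.mulVec_smul,
          h0, h1, smul_comm]
      have hdvd : ∀ j, (X 1 : R k) ^ (n + n) ∣ w0 j := by
        intro j
        refine hst.symm.dvd_of_dvd_mul_left ?_
        exact ⟨w1 j, congrFun heq j⟩
      choose u hu using hdvd
      refine ⟨u, ?_⟩
      have hw0 : w0 = (X 1 : R k) ^ (n + n) • u := funext hu
      rw [hw0, Matrix.mulVec_smul] at h0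
      exact smul_right_injective _ (pow_ne_zero _ (X_ne_zero 1)) h0
    · rintro ⟨w, rfl⟩
      simp only [Matrix.mulVec, dotProduct, Finset.sum_mul]
      rw [Finset.sum_comm]
      refine Finset.sum_eq_zero fun j _ => ?_
      calc _ = (∑ i, signedMinor B i * B i j) * w j := by
            rw [Finset.sum_mul]
            exact Finset.sum_congr rfl fun i _ => by rw [hdetB]; ring
        _ = 0 := by rw [sum_signedMinor_mul, zero_mul]
  refine ⟨a, ⟨⟨?_, hrel⟩, B, hBh, hinj, ?_⟩, by rw [ha, LinearEquiv.apply_symm_apply]⟩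
  · rw [Fintype.linearIndependent_iff]
    intro c hc
    have hc' : ∑ i, C (c i) * (a i : R k) = 0 := by
      have := congrArg (Subtype.val) hc
      simpa [smul_eq_C_mul] using this
    -- A constant relation lies in the image of `B`, whose entries have no constant term since every
    -- `μ j` is positive.
    obtain ⟨w, hw⟩ := (hexact fun i => C (c i)).1 hc'
    intro i
    have h1 := congrArg constantCoeff (congrFun hw i)
    rw [constantCoeff_C] at h1
    rw [← h1, Matrix.mulVec, dotProduct, map_sum]
    refine Finset.sum_eq_zero fun j _ => ?_
    rw [map_mul, constantCoeff_eq, (hBh i j).coeff_eq_zero, zero_mul]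
    have := hμ.pos j
    simp
    omega
  · intro v
    have := hexact v
    simpa [Fintype.linearCombination_apply] using this

end Stratum

/-! ### Independent vectors and nonvanishing minors -/

section LinearAlgebra

variable {F : Type*} [Field F]

/-- Greedy choice: the vectors already chosen span only dimension `j`, so they cannot exhaust `Λ j`.
-/
theorem exists_linearIndependent_of_lt_finrank {V : Type*} [AddCommGroup V] [Module F V] {d : ℕ}
    (Λ : Fin d → Submodule F V) (h : ∀ j : Fin d, (j : ℕ) < Module.finrank F (Λ j)) :
    ∃ e : Fin d → V, (∀ j, e j ∈ Λ j) ∧ LinearIndependent F e := by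
  induction d with
  | zero => exact ⟨Fin.elim0, fun j => j.elim0, linearIndependent_empty_type⟩
  | succ d ih =>
    obtain ⟨e, he, hli⟩ := ih (fun j => Λ j.castSucc) fun j => h j.castSucc
    have hlast := h (Fin.last d)
    obtain ⟨x, hx, hx'⟩ : ∃ x ∈ Λ (Fin.last d), x ∉ Submodule.span F (Set.range e) := by
      by_contra! hcon
      have := FiniteDimensional.span_of_finite F (Set.finite_range e)
      have h1 := Submodule.finrank_mono (show Λ (Fin.last d) ≤ _ from hcon)
      rw [finrank_span_eq_card hli, Fintype.card_fin] at h1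
      rw [Fin.val_last] at hlast
      omega
    refine ⟨Fin.snoc e x, fun j => ?_, linearIndependent_finSnoc.2 ⟨hli, hx'⟩⟩
    refine Fin.lastCases ?_ (fun j => ?_) j
    · simpa using hx
    · simpa using he j

/-- A column outside the span completes `E` to an invertible matrix; expanding its determinant along
that column, some minor must survive. -/
theorem exists_signedMinor_ne_zero {d : ℕ} {E : Matrix (Fin (d + 1)) (Fin d) F}
    (hE : LinearIndependent F E.col) : ∃ i, signedMinor E i ≠ 0 := by
  obtain ⟨w, hw⟩ : ∃ w, w ∉ Submodule.span F (Set.range E.col) := by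
    by_contra! hcon
    have h1 := Submodule.finrank_mono (show ⊤ ≤ Submodule.span F (Set.range E.col) from
      fun x _ => hcon x)
    rw [finrank_span_eq_card hE, Fintype.card_fin, finrank_top, Module.finrank_fin_fun] at h1
    omega
  let B : Matrix (Fin (d + 1)) (Fin (d + 1)) F := Matrix.of fun i => Fin.cons (w i) (E i)
  have hB : LinearIndependent F B.col := by
    have : B.col = Fin.cons w E.col := by
      ext j i
      refine Fin.cases ?_ (fun j => ?_) j <;> rfl
    rw [this]
    exact linearIndependent_finCons.2 ⟨hE, hw⟩
  rw [Matrix.linearIndependent_cols_iff_isUnit, Matrix.isUnit_iff_isUnit_det,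
    isUnit_iff_ne_zero] at hB
  by_contra! h
  apply hB
  rw [Matrix.det_succ_column B 0]
  refine Finset.sum_eq_zero fun i _ => ?_
  have h1 : B.submatrix i.succAbove (Fin.succAbove 0) = E.submatrix i.succAbove id := by
    ext a b
    simp [B]
  have h2 := h i
  rw [signedMinor] at h2
  rw [h1, Fin.val_zero, add_zero, mul_right_comm, h2, zero_mul]

theorem exists_linearIndependent_col {m p : Type*} [Fintype p] (N : Matrix m p F) {s : ℕ}
    (h : s ≤ N.rank) : ∃ g : Fin s → p, LinearIndependent F fun j => N.col (g j) := by
  rw [Matrix.rank_eq_finrank_span_cols] at h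
  have := FiniteDimensional.span_of_finite F (Set.finite_range N.col)
  obtain ⟨f, hf, -, hli⟩ := Submodule.exists_fun_fin_finrank_span_eq F (Set.range N.col)
  choose g hg using hf
  refine ⟨fun j => g (Fin.castLE h j), ?_⟩
  simp only [hg]
  exact hli.comp _ (Fin.castLE_injective h)

theorem exists_det_submatrix_ne_zero {m p : Type*} [Fintype m] [Fintype p] (N : Matrix m p F)
    {s : ℕ} (h : s ≤ N.rank) :
    ∃ (f : Fin s → m) (g : Fin s → p), (N.submatrix f g).det ≠ 0 := by
  obtain ⟨g, hg⟩ := exists_linearIndependent_col N h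
  have hr : s ≤ (N.submatrix id g).transpose.rank := by
    have h1 : LinearIndependent F (N.submatrix id g).transpose.row := hg
    rw [h1.rank_matrix, Fintype.card_fin]
  obtain ⟨f, hf⟩ := exists_linearIndependent_col _ hr
  refine ⟨f, g, ?_⟩
  have h2 : LinearIndependent F (N.submatrix f g).row := hf
  rwa [Matrix.linearIndependent_rows_iff_isUnit, Matrix.isUnit_iff_isUnit_det,
    isUnit_iff_ne_zero] at h2

theorem le_rank_iff_exists_det {m p : Type*} [Fintype m] [Fintype p] (N : Matrix m p F) {s : ℕ} :
    s ≤ N.rank ↔ ∃ (f : Fin s → m) (g : Fin s → p), (N.submatrix f g).det ≠ 0 := by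
  refine ⟨exists_det_submatrix_ne_zero N, ?_⟩
  rintro ⟨f, g, h⟩
  have := Matrix.rank_submatrix_le N f g
  rwa [Matrix.rank_of_det_ne_zero h, Fintype.card_fin] at this

end LinearAlgebra

/-! ### Scaling the minors -/

section Scaling

variable {S : Type*} [CommRing S] {d : ℕ}

/-- One column is multiplied by `c`, which is why a column has to exist. -/
theorem exists_scaled_signedMinor (hd : 0 < d) {μ : Fin d → ℕ}
    {A : Matrix (Fin (d + 1)) (Fin d) S[X]} (hA : ∀ i j, (A i j).natDegree ≤ μ j) (c : S) :
    ∃ A' : Matrix (Fin (d + 1)) (Fin d) S[X], (∀ i j, (A' i j).natDegree ≤ μ j) ∧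
      ∀ i, signedMinor A' i = signedMinor A i * Polynomial.C c := by
  classical
  let δ : Fin d → S := Function.update 1 ⟨0, hd⟩ c
  refine ⟨A * Matrix.diagonal fun j => Polynomial.C (δ j), fun i j => ?_, fun i => ?_⟩
  · rw [Matrix.mul_diagonal]
    exact (Polynomial.natDegree_mul_C_le _ _).trans (hA i j)
  · rw [signedMinor_mul, Matrix.det_diagonal, ← map_prod, Finset.prod_update_of_mem (by simp)]
    simp

end Scaling

/-! ### Recovering a Hilbert–Burch matrix from ranks -/

section HilbertBurch

variable {k : Type*} [Field k] {n d : ℕ} {μ : Fin d → ℕ}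

instance finite_syz (a : Fin (d + 1) → k[X]) (M : ℕ) : Module.Finite k (syz a M) := by
  refine Submodule.finiteDimensional_of_le (S₂ := LinearMap.range (tuple (M := M))) ?_
  intro v hv
  exact ⟨_, tuple_coeff (mem_syz.1 hv).1⟩

theorem mem_degreeLT_of_coeff_eq_zero {p : k[X]} {M : ℕ}
    (hp : p ∈ Polynomial.degreeLT k (M + 1)) (h : p.coeff M = 0) :
    p ∈ Polynomial.degreeLT k M := by
  rw [mem_degreeLT_iff_coeff] at hp ⊢
  intro l hl
  rcases hl.eq_or_lt with rfl | hl
  · exact h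
  · exact hp l hl

/-- The map sending a tuple of polynomials to the vector of their `M`-th coefficients. -/
noncomputable def leadMap (k : Type*) [Field k] (d M : ℕ) :
    (Fin (d + 1) → k[X]) →ₗ[k] (Fin (d + 1) → k) :=
  LinearMap.pi fun i => (Polynomial.lcoeff k M).comp (LinearMap.proj i)

/-- Rank-nullity for the `M`-th coefficients: a syzygy in `syz a (M + 1)` where they vanish lies in
`syz a M`. -/
theorem finrank_map_leadMap (a : Fin (d + 1) → k[X]) (M : ℕ) :
    Module.finrank k ((syz a (M + 1)).map (leadMap k d M)) + Module.finrank k (syz a M) =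
      Module.finrank k (syz a (M + 1)) := by
  have hle : syz a M ≤ syz a (M + 1) := by
    intro v hv
    rw [mem_syz] at hv ⊢
    exact ⟨fun i => Polynomial.degreeLT_mono (Nat.le_succ M) (hv.1 i), hv.2⟩
  have hker : LinearMap.ker ((leadMap k d M).domRestrict (syz a (M + 1))) =
      (syz a M).comap (syz a (M + 1)).subtype := by
    ext v
    have hv := mem_syz.1 v.2
    constructor
    · intro h
      refine mem_syz.2 ⟨fun i => mem_degreeLT_of_coeff_eq_zero (hv.1 i) ?_, hv.2⟩
      exact congrFun h i
    · intro h
      have h' := mem_syz.1 h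
      ext i
      exact mem_degreeLT_iff_coeff.1 (h'.1 i) M le_rfl
  have := LinearMap.finrank_range_add_finrank_ker ((leadMap k d M).domRestrict (syz a (M + 1)))
  rw [hker, (Submodule.comapSubtypeEquivOfLe hle).finrank_eq, LinearMap.range_domRestrict] at this
  exact this

/-- From `μ j` to `μ j + 1` the Hilbert function grows by the number of `i` with `μ i ≤ μ j`. By
monotonicity these include the `j + 1` indices `i ≤ j`. -/
theorem lt_finrank_map_leadMap {μ : Fin d → ℕ} (hμ : Monotone μ) {a : Fin (d + 1) → k[X]} (j : Fin d)
    (h0 : Module.finrank k (syz a (μ j)) = ∑ i, (μ j - μ i))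
    (h1 : Module.finrank k (syz a (μ j + 1)) = ∑ i, (μ j + 1 - μ i)) :
    (j : ℕ) < Module.finrank k ((syz a (μ j + 1)).map (leadMap k d (μ j))) := by
  have h := finrank_map_leadMap a (μ j)
  rw [h0, h1] at h
  have hsum : ∑ i, (μ j - μ i) + ∑ i, (if i ≤ j then 1 else 0) ≤ ∑ i, (μ j + 1 - μ i) := by
    rw [← Finset.sum_add_distrib]
    refine Finset.sum_le_sum fun i _ => ?_
    split_ifs with hij
    · have := hμ hij
      omega
    · omega
  have hcard : ∑ i, (if i ≤ j then 1 else 0) = (j : ℕ) + 1 := by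
    rw [← Finset.sum_filter, Finset.sum_const, smul_eq_mul, mul_one]
    rw [Finset.filter_ge_eq_Iic, Fin.card_Iic]
  omega

/-- Syzygies with independent leading vectors form a matrix with a minor of exact degree `n`. Its
minors are proportional to `a`, and coprimality together with the degree makes the factor a
constant. -/
theorem exists_signedMinor_eq (hd : 0 < d) (hμ : IsPartition μ n)
    {x : Fin (d + 1) × Fin (n + 1) → k} (hr : (mulMatrix n x).rank = n + n + 1)
    (h : ∀ j : Fin d, Module.finrank k (syz (tuple x) (μ j)) = ∑ i, (μ j - μ i) ∧
      Module.finrank k (syz (tuple x) (μ j + 1)) = ∑ i, (μ j + 1 - μ i)) :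
    ∃ A : Matrix (Fin (d + 1)) (Fin d) k[X], (∀ i j, (A i j).natDegree ≤ μ j) ∧
      ∀ i, tuple x i = signedMinor A i := by
  set a := tuple x with ha
  obtain ⟨e, he, hli⟩ := exists_linearIndependent_of_lt_finrank
    (fun j => (syz a (μ j + 1)).map (leadMap k d (μ j)))
    fun j : Fin d => lt_finrank_map_leadMap hμ.mono j (h j).1 (h j).2
  choose v hv hve using he
  set A : Matrix (Fin (d + 1)) (Fin d) k[X] := Matrix.of fun i j => v j i with hA
  have hdeg : ∀ i j, (A i j).natDegree ≤ μ j := fun i j =>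
    mem_degreeLT_succ_iff.1 ((mem_syz.1 (hv j)).1 i)
  have hzero : ∀ j, ∑ i, a i * A i j = 0 := by
    intro j
    rw [← (mem_syz.1 (hv j)).2]
    exact Finset.sum_congr rfl fun i _ => mul_comm _ _
  obtain ⟨i0, hi0⟩ : ∃ i, signedMinor A i ≠ 0 := by
    have hE : LinearIndependent k (Matrix.of fun i j => (A i j).coeff (μ j)).col := by
      have : (Matrix.of fun i j => (A i j).coeff (μ j)).col = e := by
        ext j i
        rw [← hve j]
        rfl
      rwa [this]
    obtain ⟨i, hi⟩ := exists_signedMinor_ne_zero hE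
    refine ⟨i, fun h0 => hi ?_⟩
    rw [← coeff_signedMinor_sum hdeg, h0, Polynomial.coeff_zero]
  have hprop := signedMinor_mul_eq_of_vecMul_eq_zero A hzero hi0
  obtain ⟨b, hb⟩ : ∃ b : Fin (d + 1) → k[X], ∑ i, b i * a i = 1 := exists_bezout_of_rank hr
  -- If the minors are `β * a`, pairing them with the Bezout coefficients of `a` must return `β`.
  set β := ∑ r, b r * signedMinor A r with hβ
  have h1 : signedMinor A i0 = a i0 * β := by
    calc signedMinor A i0 = ∑ r, b r * (signedMinor A i0 * a r) := by
          conv_lhs => rw [← mul_one (signedMinor A i0), ← hb, Finset.mul_sum]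
          exact Finset.sum_congr rfl fun r _ => by ring
      _ = a i0 * β := by
          rw [hβ, Finset.mul_sum]
          exact Finset.sum_congr rfl fun r _ => by rw [hprop]; ring
  have hai0 : a i0 ≠ 0 := fun h0 => hi0 (by rw [h1, h0, zero_mul])
  have hβ0 : β ≠ 0 := fun h0 => hi0 (by rw [h1, h0, mul_zero])
  have h2 : ∀ r, signedMinor A r = β * a r := by
    intro r
    apply mul_left_cancel₀ hai0
    rw [← hprop, h1, mul_assoc]
  obtain ⟨r, hrn⟩ := exists_coeff_ne_zero_of_rank hr
  -- Some `a r` has degree exactly `n`, whereas `β * a r` is a minor of degree at most `∑ μ j = n`.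
  have hβd : β.natDegree = 0 := by
    have h3 := natDegree_signedMinor_le hdeg r
    have har : a r ≠ 0 := fun h0 => hrn (by rw [← ha, h0, Polynomial.coeff_zero])
    have h4 := Polynomial.le_natDegree_of_ne_zero hrn
    rw [h2, Polynomial.natDegree_mul hβ0 har, hμ.sum_eq] at h3
    rw [← ha] at h4
    omega
  rw [Polynomial.natDegree_eq_zero] at hβd
  obtain ⟨c, hc⟩ := hβd
  have hc0 : c ≠ 0 := by
    rintro rfl
    exact hβ0 (by rw [← hc, map_zero])
  obtain ⟨A', hA', hA'm⟩ := exists_scaled_signedMinor hd hdeg c⁻¹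
  refine ⟨A', hA', fun i => ?_⟩
  rw [hA'm, h2, ← hc, mul_right_comm, ← map_mul, mul_inv_cancel₀ hc0, map_one, one_mul]

theorem IsPartition.le {d n : ℕ} {μ : Fin d → ℕ} (hμ : IsPartition μ n) (j : Fin d) : μ j ≤ n := by
  rw [← hμ.sum_eq]
  exact Finset.single_le_sum (fun _ _ => Nat.zero_le _) (Finset.mem_univ j)

theorem sum_sub_add (hμ : IsPartition μ n) : ∑ j, (n + 1 - μ j) + n = d * (n + 1) := by
  have h : ∑ j, (n + 1 - μ j) + ∑ j, μ j = d * (n + 1) := by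
    rw [← Finset.sum_add_distrib, Finset.sum_congr rfl fun j _ =>
      Nat.sub_add_cancel ((hμ.le j).trans (Nat.le_succ n))]
    simp
  rwa [hμ.sum_eq] at h

/-- The `μ`-stratum is described by the ranks of the multiplication matrices. -/
theorem mem_muStratumCoeffs_iff_rank (hd : 0 < d) (hμ : IsPartition μ n)
    {x : Fin (d + 1) × Fin (n + 1) → k} :
    x ∈ muStratumCoeffs k d n μ ↔
      ∀ m ≤ n, (mulMatrix m x).rank + ∑ j, (m + 1 - μ j) = (d + 1) * (m + 1) := by
  constructor
  · rintro ⟨a, ⟨-, ha⟩, rfl⟩ m -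
    have h := finrank_syz_of_hasMuType ha (m + 1)
    rw [← rank_add_finrank_syz (m := m) (tupleCoeffs k d n a), ← h,
      show tuple (tupleCoeffs k d n a) = _ from funext (tuple_tupleCoeffs a)]
  · intro h
    have hfin : ∀ M ≤ n + 1, Module.finrank k (syz (tuple x) M) = ∑ j, (M - μ j) := by
      intro M hM
      cases M with
      | zero =>
        have : syz (tuple x) 0 = ⊥ := by
          rw [eq_bot_iff]
          intro v hv
          ext i l
          simpa using mem_degreeLT_iff_coeff.1 ((mem_syz.1 hv).1 i) l (Nat.zero_le l)
        rw [this]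
        simp
      | succ m =>
        have h1 := h m (by omega)
        have h2 := rank_add_finrank_syz (m := m) x
        omega
    -- Since `∑ (n + 1 - μ j) = d (n + 1) - n`, the rank at `m = n` is `(n + 1) + n`.
    have hr : (mulMatrix n x).rank = n + n + 1 := by
      have h1 := h n le_rfl
      have h2 := sum_sub_add hμ
      rw [add_mul, ← h2] at h1
      omega
    obtain ⟨A, hA, hxA⟩ := exists_signedMinor_eq hd hμ hr fun j =>
      ⟨hfin _ ((hμ.le j).trans (Nat.le_succ n)), hfin _ (Nat.succ_le_succ (hμ.le j))⟩
    exact mem_muStratumCoeffs_of_signedMinor hμ hA hxA hr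

theorem rank_of_mem_muStratumCoeffs (hd : 0 < d) (hμ : IsPartition μ n)
    {x : Fin (d + 1) × Fin (n + 1) → k} (hx : x ∈ muStratumCoeffs k d n μ) :
    (mulMatrix n x).rank = n + n + 1 := by
  have h1 := (mem_muStratumCoeffs_iff_rank hd hμ).1 hx n le_rfl
  have h2 := sum_sub_add hμ
  rw [add_mul, ← h2] at h1
  omega

/-- The `μ`-stratum consists of the tuples of maximal minors satisfying a rank condition. -/
theorem mem_muStratumCoeffs_iff_exists (hd : 0 < d) (hμ : IsPartition μ n)
    {x : Fin (d + 1) × Fin (n + 1) → k} :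
    x ∈ muStratumCoeffs k d n μ ↔ (mulMatrix n x).rank = n + n + 1 ∧
      ∃ A : Matrix (Fin (d + 1)) (Fin d) k[X], (∀ i j, (A i j).natDegree ≤ μ j) ∧
        ∀ i, tuple x i = signedMinor A i := by
  constructor
  · intro hx
    have hr := rank_of_mem_muStratumCoeffs hd hμ hx
    refine ⟨hr, exists_signedMinor_eq hd hμ hr ?_⟩
    obtain ⟨a, ⟨-, ha⟩, rfl⟩ := hx
    intro j
    have h := fun M => finrank_syz_of_hasMuType ha M
    rw [← show tuple (tupleCoeffs k d n a) = _ from funext (tuple_tupleCoeffs a)] at h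
    exact ⟨h _, h _⟩
  · rintro ⟨hr, A, hA, hxA⟩
    exact mem_muStratumCoeffs_of_signedMinor hμ hA hxA hr

end HilbertBurch

/-! ### Rank conditions in the Zariski topology -/

section Topology

variable {k σ : Type*} [Field k]

theorem mem_zeroLocus_span {s : Set (MvPolynomial σ k)} {x : σ → k} :
    x ∈ zeroLocus k (Ideal.span s) ↔ ∀ p ∈ s, eval x p = 0 := by
  constructor
  · intro h p hp
    simpa using h p (Ideal.subset_span hp)
  · intro h
    have : Ideal.span s ≤ RingHom.ker (eval x) := Ideal.span_le.2 h
    intro p hp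
    simpa using this hp

theorem isClosed_forall_eval_eq_zero (s : Set (MvPolynomial σ k)) :
    IsClosed[zariski k σ] {x | ∀ p ∈ s, eval x p = 0} :=
  (isClosed_zariski_iff _).2 ⟨Ideal.span s, by ext x; exact mem_zeroLocus_span.symm⟩

theorem exists_eval_ne_zero_of_isOpen {U : Set (σ → k)} (hU : IsOpen[zariski k σ] U) {x : σ → k}
    (hx : x ∈ U) : ∃ f : MvPolynomial σ k, eval x f ≠ 0 ∧ ∀ y, eval y f ≠ 0 → y ∈ U := by
  have hc : IsClosed[zariski k σ] Uᶜ := (@isClosed_compl_iff _ (zariski k σ) U).2 hU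
  obtain ⟨I, hI⟩ := (isClosed_zariski_iff _).1 hc
  have hx' : x ∉ zeroLocus k I := by
    rw [← hI]
    exact fun h => h hx
  rw [mem_zeroLocus_iff] at hx'
  push Not at hx'
  obtain ⟨f, hf, hf0⟩ := hx'
  refine ⟨f, by simpa using hf0, fun y hy => ?_⟩
  by_contra hyU
  have hyI : y ∈ zeroLocus k I := hI ▸ hyU
  exact hy (by simpa using hyI f hf)

theorem eval_det_submatrix {m p : Type*} (N : Matrix m p (MvPolynomial σ k)) (x : σ → k) {s : ℕ} (f : Fin s → m)
    (g : Fin s → p) :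
    eval x (N.submatrix f g).det = ((N.map (eval x)).submatrix f g).det := by
  rw [RingHom.map_det]
  rfl

variable {m p : Type*} [Fintype m] [Fintype p]

/-- The equations are the vanishing of all minors of size `s`. Selections `f`, `g` with repetitions
only add zero determinants. -/
theorem isClosed_rank_lt (N : Matrix m p (MvPolynomial σ k)) (s : ℕ) :
    IsClosed[zariski k σ] {x | (N.map (eval x)).rank < s} := by
  convert! isClosed_forall_eval_eq_zero (k := k)
    {q | ∃ (f : Fin s → m) (g : Fin s → p), q = (N.submatrix f g).det} using 1
  ext x
  rw [Set.mem_ofPred_eq, ← not_le, le_rank_iff_exists_det]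
  push Not
  constructor
  · rintro h _ ⟨f, g, rfl⟩
    rw [eval_det_submatrix]
    exact h f g
  · intro h f g
    rw [← eval_det_submatrix]
    exact h _ ⟨f, g, rfl⟩

theorem isClosed_rank_add_le (N : Matrix m p (MvPolynomial σ k)) (s t : ℕ) :
    IsClosed[zariski k σ] {x | (N.map (eval x)).rank + s ≤ t} := by
  convert! isClosed_rank_lt N (t + 1 - s) using 1
  ext x
  simp only [Set.mem_ofPred_eq]
  omega

theorem isOpen_le_rank_add (N : Matrix m p (MvPolynomial σ k)) (s t : ℕ) :
    IsOpen[zariski k σ] {x | t ≤ (N.map (eval x)).rank + s} := by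
  have h : IsOpen[zariski k σ] {x | (N.map (eval x)).rank < t - s}ᶜ :=
    (@isOpen_compl_iff _ _ (zariski k σ)).2 (isClosed_rank_lt N (t - s))
  convert! h using 1
  ext x
  simp only [Set.mem_ofPred_eq, Set.mem_compl_iff]
  omega

end Topology

/-! ### Local closedness -/

section LocallyClosed

variable {k : Type*} [Field k] {n d : ℕ} {μ : Fin d → ℕ}

theorem map_mulMatrix_X {m : ℕ} (x : Fin (d + 1) × Fin (n + 1) → k) :
    (mulMatrix m (X : _ → MvPolynomial (Fin (d + 1) × Fin (n + 1)) k)).map (eval x) =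
      mulMatrix m x := by
  rw [map_mulMatrix]
  simp only [eval_X]

theorem exists_isClosed_inter_isOpen (hd : 0 < d) (hμ : IsPartition μ n) :
    ∃ Z U : Set (Fin (d + 1) × Fin (n + 1) → k),
      IsClosed[zariski k (Fin (d + 1) × Fin (n + 1))] Z ∧
      IsOpen[zariski k (Fin (d + 1) × Fin (n + 1))] U ∧ muStratumCoeffs k d n μ = Z ∩ U := by
  let _ := zariski k (Fin (d + 1) × Fin (n + 1))
  let N := fun m => mulMatrix m (X : _ → MvPolynomial (Fin (d + 1) × Fin (n + 1)) k)
  refine ⟨⋂ m ∈ Finset.range (n + 1), {x | ((N m).map (eval x)).rank + ∑ j, (m + 1 - μ j) ≤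
      (d + 1) * (m + 1)}, ⋂ m ∈ Finset.range (n + 1), {x | (d + 1) * (m + 1) ≤
      ((N m).map (eval x)).rank + ∑ j, (m + 1 - μ j)}, ?_, ?_, ?_⟩
  · exact isClosed_biInter fun m _ => isClosed_rank_add_le (N m) _ _
  · exact isOpen_biInter_finset fun m _ => isOpen_le_rank_add (N m) _ _
  · ext x
    rw [mem_muStratumCoeffs_iff_rank hd hμ]
    simp only [Set.mem_inter_iff, Set.mem_iInter, Set.mem_ofPred_eq, N, map_mulMatrix_X,
      Finset.mem_range, Nat.lt_succ_iff]
    exact ⟨fun h => ⟨fun m hm => (h m hm).le, fun m hm => (h m hm).ge⟩,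
      fun h m hm => le_antisymm (h.1 m hm) (h.2 m hm)⟩

end LocallyClosed

/-! ### Parametrization by matrices and irreducibility -/

section GenericMatrix

variable {S T : Type*} [CommRing S] [CommRing T] {d n : ℕ}

/-- The matrix of polynomials whose `j`-th column has degree at most `μ j`, with prescribed
coefficients. -/
noncomputable def coeffMatrix (μ : Fin d → ℕ) (y : Fin (d + 1) × Fin d × ℕ → S) :
    Matrix (Fin (d + 1)) (Fin d) S[X] :=
  Matrix.of fun i j => ∑ l ∈ Finset.range (μ j + 1), Polynomial.monomial l (y (i, j, l))

variable {μ : Fin d → ℕ}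

theorem coeff_coeffMatrix (y : Fin (d + 1) × Fin d × ℕ → S) (i : Fin (d + 1)) (j : Fin d) (l : ℕ) :
    (coeffMatrix μ y i j).coeff l = if l ≤ μ j then y (i, j, l) else 0 := by
  simp [coeffMatrix, Polynomial.finsetSum_coeff, Polynomial.coeff_monomial]

theorem natDegree_coeffMatrix_le (y : Fin (d + 1) × Fin d × ℕ → S) (i : Fin (d + 1)) (j : Fin d) :
    (coeffMatrix μ y i j).natDegree ≤ μ j := by
  rw [Polynomial.natDegree_le_iff_coeff_eq_zero]
  intro l hl
  rw [coeff_coeffMatrix, if_neg (by omega)]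

theorem coeffMatrix_coeff {A : Matrix (Fin (d + 1)) (Fin d) S[X]}
    (hA : ∀ i j, (A i j).natDegree ≤ μ j) :
    coeffMatrix μ (fun p => (A p.1 p.2.1).coeff p.2.2) = A := by
  ext i j l
  rw [coeff_coeffMatrix]
  split_ifs with h
  · rfl
  · exact (Polynomial.natDegree_le_iff_coeff_eq_zero.1 (hA i j) l (by omega)).symm

theorem map_coeffMatrix (f : S →+* T) (y : Fin (d + 1) × Fin d × ℕ → S) :
    (coeffMatrix μ y).map (Polynomial.mapRingHom f) = coeffMatrix μ fun p => f (y p) := by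
  ext i j l
  simp only [Matrix.map_apply, Polynomial.coe_mapRingHom, Polynomial.coeff_map, coeff_coeffMatrix]
  split_ifs <;> simp

/-- The coefficients of the signed maximal minors. -/
noncomputable def minorCoeffs (n : ℕ) (A : Matrix (Fin (d + 1)) (Fin d) S[X])
    (p : Fin (d + 1) × Fin (n + 1)) : S := (signedMinor A p.1).coeff p.2

theorem tuple_minorCoeffs {A : Matrix (Fin (d + 1)) (Fin d) S[X]}
    (hA : ∀ i j, (A i j).natDegree ≤ μ j) (hμ : ∑ j, μ j = n) (i : Fin (d + 1)) :
    tuple (minorCoeffs n A) i = signedMinor A i := by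
  refine congrFun (tuple_coeff (v := signedMinor A) fun i => ?_) i
  rw [mem_degreeLT_succ_iff, ← hμ]
  exact natDegree_signedMinor_le hA i

theorem map_minorCoeffs (f : S →+* T) (A : Matrix (Fin (d + 1)) (Fin d) S[X])
    (p : Fin (d + 1) × Fin (n + 1)) :
    f (minorCoeffs n A p) = minorCoeffs n (A.map (Polynomial.mapRingHom f)) p := by
  rw [minorCoeffs, minorCoeffs, signedMinor_map, Polynomial.coe_mapRingHom, Polynomial.coeff_map]

variable {k : Type*} [Field k]

/-- The parametrization of the `μ`-stratum by coefficients of Hilbert--Burch matrices. -/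
noncomputable def minorMap (k : Type*) [Field k] (n : ℕ) (μ : Fin d → ℕ)
    (p : Fin (d + 1) × Fin (n + 1)) : MvPolynomial (Fin (d + 1) × Fin d × ℕ) k :=
  minorCoeffs n (coeffMatrix μ X) p

theorem eval_minorMap (y : Fin (d + 1) × Fin d × ℕ → k) (p : Fin (d + 1) × Fin (n + 1)) :
    eval y (minorMap k n μ p) = minorCoeffs n (coeffMatrix μ y) p := by
  rw [minorMap, map_minorCoeffs, map_coeffMatrix]
  simp only [eval_X]

theorem eval_bind_minorMap (y : Fin (d + 1) × Fin d × ℕ → k)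
    (f : MvPolynomial (Fin (d + 1) × Fin (n + 1)) k) :
    eval y (bind₁ (minorMap k n μ) f) = eval (minorCoeffs n (coeffMatrix μ y)) f := by
  rw [eval, eval₂Hom_bind₁]
  change eval₂ _ _ f = eval₂ _ _ f
  congr 1
  ext p
  exact eval_minorMap y p

theorem minorCoeffs_mem_iff (hd : 0 < d) (hμ : IsPartition μ n)
    {A : Matrix (Fin (d + 1)) (Fin d) k[X]} (hA : ∀ i j, (A i j).natDegree ≤ μ j) :
    minorCoeffs n A ∈ muStratumCoeffs k d n μ ↔
      (mulMatrix n (minorCoeffs n A)).rank = n + n + 1 := by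
  rw [mem_muStratumCoeffs_iff_exists hd hμ]
  exact ⟨fun h => h.1, fun h => ⟨h, A, hA, tuple_minorCoeffs hA hμ.sum_eq⟩⟩

theorem exists_minorCoeffs_eq (hd : 0 < d) (hμ : IsPartition μ n)
    {x : Fin (d + 1) × Fin (n + 1) → k} (hx : x ∈ muStratumCoeffs k d n μ) :
    ∃ y, minorCoeffs n (coeffMatrix μ y) = x := by
  obtain ⟨-, A, hA, hxA⟩ := (mem_muStratumCoeffs_iff_exists hd hμ).1 hx
  refine ⟨fun p => (A p.1 p.2.1).coeff p.2.2, ?_⟩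
  rw [coeffMatrix_coeff hA]
  apply tuple_injective
  ext1 i
  rw [tuple_minorCoeffs hA hμ.sum_eq, hxA]

theorem minorCoeffs_mem_of_rank (hd : 0 < d) (hμ : IsPartition μ n)
    {y : Fin (d + 1) × Fin d × ℕ → k}
    (h : n + n + 1 ≤ (mulMatrix n (minorCoeffs n (coeffMatrix μ y))).rank) :
    minorCoeffs n (coeffMatrix μ y) ∈ muStratumCoeffs k d n μ := by
  rw [minorCoeffs_mem_iff hd hμ (natDegree_coeffMatrix_le y)]
  refine le_antisymm ?_ h
  simpa using Matrix.rank_le_card_height (mulMatrix n (minorCoeffs n (coeffMatrix μ y)))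

/-- Basic open sets meeting the stratum pull back to nonzero polynomials on the parameter space.
Over an infinite field their product is nonzero at some point. -/
theorem isPreirreducible_muStratumCoeffs [Infinite k] (hd : 0 < d) (hμ : IsPartition μ n) :
    @IsPreirreducible _ (zariski k (Fin (d + 1) × Fin (n + 1))) (muStratumCoeffs k d n μ) := by
  let _ := zariski k (Fin (d + 1) × Fin (n + 1))
  rintro u v hu hv ⟨x₁, hx₁, hxu⟩ ⟨x₂, hx₂, hxv⟩
  obtain ⟨f₁, hf₁, hf₁u⟩ := exists_eval_ne_zero_of_isOpen hu hxu
  obtain ⟨f₂, hf₂, hf₂v⟩ := exists_eval_ne_zero_of_isOpen hv hxv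
  -- The third polynomial forces full rank, so that the common parameter maps into the stratum.
  obtain ⟨f₃, hf₃, hf₃r⟩ := exists_eval_ne_zero_of_isOpen
    (isOpen_le_rank_add (mulMatrix n (X : _ → MvPolynomial (Fin (d + 1) × Fin (n + 1)) k)) 0
      (n + n + 1)) (x := x₁) (by
        rw [Set.mem_ofPred_eq, map_mulMatrix_X, rank_of_mem_muStratumCoeffs hd hμ hx₁])
  simp only [Set.mem_ofPred_eq, map_mulMatrix_X, add_zero] at hf₃r
  have hne : ∀ {x f}, x ∈ muStratumCoeffs k d n μ → eval x f ≠ 0 →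
      bind₁ (minorMap k n μ) f ≠ 0 := by
    intro x f hx hf h0
    obtain ⟨y, rfl⟩ := exists_minorCoeffs_eq hd hμ hx
    rw [← eval_bind_minorMap, h0, map_zero] at hf
    exact hf rfl
  have hprod := mul_ne_zero (mul_ne_zero (hne hx₁ hf₁) (hne hx₂ hf₂)) (hne hx₁ hf₃)
  obtain ⟨y, hy⟩ : ∃ y, eval y (bind₁ (minorMap k n μ) f₁ * bind₁ (minorMap k n μ) f₂ *
      bind₁ (minorMap k n μ) f₃) ≠ 0 := by
    by_contra! h
    exact hprod (MvPolynomial.funext fun y => by rw [h y, map_zero])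
  simp only [map_mul, eval_bind_minorMap] at hy
  refine ⟨minorCoeffs n (coeffMatrix μ y), ?_, hf₁u _ ?_, hf₂v _ ?_⟩
  · exact minorCoeffs_mem_of_rank hd hμ (hf₃r _ (right_ne_zero_of_mul hy))
  · exact left_ne_zero_of_mul (left_ne_zero_of_mul hy)
  · exact right_ne_zero_of_mul (left_ne_zero_of_mul hy)

end GenericMatrix

/-! ### A point of the stratum -/

section Witness

variable {k : Type*} [Field k] {n d : ℕ} {μ : Fin d → ℕ}

/-- The bidiagonal matrix with entries `X ^ μ j` on the diagonal and `1` below it. -/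
noncomputable def bidiagonal (k : Type*) [Field k] (μ : Fin d → ℕ) :
    Matrix (Fin (d + 1)) (Fin d) k[X] :=
  Matrix.of fun i j => if i = j.castSucc then Polynomial.X ^ μ j else if i = j.succ then 1 else 0

theorem natDegree_bidiagonal_le (i : Fin (d + 1)) (j : Fin d) :
    (bidiagonal k μ i j).natDegree ≤ μ j := by
  simp only [bidiagonal, Matrix.of_apply]
  split_ifs <;> simp

theorem signedMinor_bidiagonal_zero : signedMinor (bidiagonal k μ) 0 = 1 := by
  have h : ((bidiagonal k μ).submatrix (Fin.succAbove 0) id).BlockTriangular id := by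
    intro i j hij
    simp only [id_eq, Fin.lt_def] at hij
    simp only [Matrix.submatrix_apply, Fin.succAbove_zero, id_eq, bidiagonal, Matrix.of_apply]
    rw [if_neg, if_neg]
    · simp only [Fin.ext_iff, Fin.val_succ]
      omega
    · simp only [Fin.ext_iff, Fin.val_succ, Fin.val_castSucc]
      omega
  rw [signedMinor, Matrix.det_of_isUpperTriangular h]
  simp [bidiagonal, Fin.ext_iff]

theorem signedMinor_bidiagonal_last (hμ : ∑ j, μ j = n) :
    signedMinor (bidiagonal k μ) (Fin.last d) = (-1) ^ d * Polynomial.X ^ n := by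
  have h : ((bidiagonal k μ).submatrix (Fin.succAbove (Fin.last d)) id).BlockTriangular
      OrderDual.toDual := by
    intro i j hij
    rw [OrderDual.toDual_lt_toDual, Fin.lt_def] at hij
    simp only [Matrix.submatrix_apply, Fin.succAbove_last, id_eq, bidiagonal, Matrix.of_apply]
    rw [if_neg, if_neg]
    · simp only [Fin.ext_iff, Fin.val_succ, Fin.val_castSucc]
      omega
    · simp only [Fin.ext_iff, Fin.val_castSucc]
      omega
  rw [signedMinor, Matrix.det_of_isLowerTriangular _ h]
  simp [bidiagonal, Finset.prod_pow_eq_pow_sum, hμ]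

/-- The first and last minors are `1` and `± X ^ n`. With multipliers of degree at most `n` the
first reaches `X ^ r` for `r ≤ n`, the last for `n < r ≤ 2n`. -/
theorem rank_mulMatrix_bidiagonal (hμ : ∑ j, μ j = n) :
    (mulMatrix n (minorCoeffs n (bidiagonal k μ))).rank = n + n + 1 := by
  rw [rank_mulMatrix_eq_iff]
  have ht := tuple_minorCoeffs (natDegree_bidiagonal_le (k := k) (μ := μ)) hμ
  have hsingle : ∀ (i0 : Fin (d + 1)) (q : k[X]), q.natDegree ≤ n →
      ∃ b : Fin (d + 1) → k[X], (∀ i, (b i).natDegree ≤ n) ∧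
        ∑ i, b i * tuple (minorCoeffs n (bidiagonal k μ)) i =
          q * signedMinor (bidiagonal k μ) i0 := by
    intro i0 q hq
    refine ⟨Pi.single i0 q, fun i => ?_, ?_⟩
    · by_cases h : i = i0
      · subst h
        simpa using hq
      · simp [h]
    · rw [Finset.sum_eq_single i0]
      · rw [Pi.single_eq_same, ht]
      · intro i _ hi
        rw [Pi.single_eq_of_ne hi, zero_mul]
      · simp
  intro r hr
  rcases le_or_gt r n with h | h
  · obtain ⟨b, hb, hbr⟩ := hsingle 0 (Polynomial.X ^ r) (by simpa using h)
    exact ⟨b, hb, by rw [hbr, signedMinor_bidiagonal_zero, mul_one]⟩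
  · obtain ⟨b, hb, hbr⟩ := hsingle (Fin.last d) ((-1) ^ d * Polynomial.X ^ (r - n)) (by
      rw [neg_one_pow_eq_C]
      exact (Polynomial.natDegree_C_mul_X_pow_le _ _).trans (by omega))
    refine ⟨b, hb, ?_⟩
    rw [hbr, signedMinor_bidiagonal_last hμ, mul_mul_mul_comm, ← pow_add, ← pow_add,
      Even.neg_one_pow ⟨d, rfl⟩, one_mul, Nat.sub_add_cancel h.le]

theorem isIrreducible_muStratumCoeffs [Infinite k] (hd : 0 < d) (hμ : IsPartition μ n) :
    @IsIrreducible _ (zariski k (Fin (d + 1) × Fin (n + 1))) (muStratumCoeffs k d n μ) :=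
  ⟨⟨_, (minorCoeffs_mem_iff hd hμ natDegree_bidiagonal_le).2
    (rank_mulMatrix_bidiagonal hμ.sum_eq)⟩, isPreirreducible_muStratumCoeffs hd hμ⟩

end Witness

/-! ### Normal forms of Hilbert–Burch matrices -/

section Slice

variable {S T : Type*} [CommRing S] [CommRing T] {d n : ℕ}

/-- The number of free coefficients of an entry of a matrix in normal form. -/
def sliceBound (μ : Fin d → ℕ) (i : Fin (d + 1)) (j : Fin d) : ℕ :=
  Fin.lastCases (motive := fun _ => ℕ) (μ j + 1) (fun i => min (μ j + 1) (μ i)) i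

theorem sliceBound_last (μ : Fin d → ℕ) (j : Fin d) : sliceBound μ (Fin.last d) j = μ j + 1 := by
  simp [sliceBound]

theorem sliceBound_castSucc (μ : Fin d → ℕ) (i j : Fin d) :
    sliceBound μ i.castSucc j = min (μ j + 1) (μ i) := by
  simp [sliceBound]

theorem sliceBound_le (μ : Fin d → ℕ) (i : Fin (d + 1)) (j : Fin d) :
    sliceBound μ i j ≤ μ j + 1 := by
  refine Fin.lastCases ?_ (fun i => ?_) i
  · rw [sliceBound_last]
  · rw [sliceBound_castSucc]
    exact min_le_left _ _

/-- The free coefficients of a matrix in normal form, together with one scaling parameter. -/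
abbrev SliceIndex (μ : Fin d → ℕ) : Type :=
  Option (Σ p : Fin (d + 1) × Fin d, Fin (sliceBound μ p.1 p.2))

variable (μ : Fin d → ℕ)

/-- The matrix in normal form with given free coefficients: in the `i`-th row of the upper square
block the diagonal entry is monic of degree `μ i`, and the other entries have smaller degree. -/
noncomputable def sliceMatrix (z : SliceIndex μ → S) : Matrix (Fin (d + 1)) (Fin d) S[X] :=
  Matrix.of fun i j => ofCoeffs (fun l : Fin (sliceBound μ i j) => z (some ⟨(i, j), l⟩)) +
    if i = j.castSucc then Polynomial.X ^ μ j else 0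

/-- Being in normal form: columns of bounded degree, and an upper square block whose row-leading
coefficient matrix is the identity. -/
def IsNormalForm (A : Matrix (Fin (d + 1)) (Fin d) S[X]) : Prop :=
  (∀ i j, (A i j).natDegree ≤ μ j) ∧
    ∀ i j l, μ i ≤ l → (A (Fin.castSucc i) j).coeff l = if i = j ∧ l = μ j then 1 else 0

variable {μ}

theorem coeff_sliceMatrix (z : SliceIndex μ → S) (i : Fin (d + 1)) (j : Fin d) (l : ℕ) :
    (sliceMatrix μ z i j).coeff l =
      (if h : l < sliceBound μ i j then z (some ⟨(i, j), ⟨l, h⟩⟩) else 0) +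
        if i = j.castSucc ∧ l = μ j then 1 else 0 := by
  simp only [sliceMatrix, Matrix.of_apply, Polynomial.coeff_add, coeff_ofCoeffs]
  congr 1
  by_cases h : i = j.castSucc
  · simp [h, Polynomial.coeff_X_pow]
  · simp [h]

theorem isNormalForm_sliceMatrix (z : SliceIndex μ → S) : IsNormalForm μ (sliceMatrix μ z) := by
  constructor
  · intro i j
    rw [Polynomial.natDegree_le_iff_coeff_eq_zero]
    intro l hl
    have := sliceBound_le μ i j
    rw [coeff_sliceMatrix, dif_neg (by omega), if_neg (by omega), add_zero]
  · intro i j l hl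
    rw [coeff_sliceMatrix, dif_neg, zero_add]
    · simp
    · rw [sliceBound_castSucc]
      have := min_le_right (μ j + 1) (μ i)
      omega

theorem IsNormalForm.eq_sliceMatrix {A : Matrix (Fin (d + 1)) (Fin d) S[X]}
    (hA : IsNormalForm μ A) (c : S) :
    sliceMatrix μ (fun q => q.elim c fun p => (A p.1.1 p.1.2).coeff p.2) = A := by
  ext i j l
  rw [coeff_sliceMatrix]
  by_cases hl : l ≤ μ j
  · revert i
    refine Fin.lastCases ?_ fun i => ?_
    · rw [dif_pos (by rw [sliceBound_last]; omega), if_neg, add_zero]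
      · rfl
      · rintro ⟨h, -⟩
        exact (Fin.castSucc_ne_last j) h.symm
    · by_cases h : l < μ i
      · rw [dif_pos (by rw [sliceBound_castSucc, lt_min_iff]; omega), if_neg, add_zero]
        · rfl
        · rintro ⟨h1, h2⟩
          rw [Fin.castSucc_injective d h1] at h
          omega
      · rw [dif_neg (by rw [sliceBound_castSucc, lt_min_iff]; omega), zero_add,
          hA.2 i j l (by omega)]
        simp
  · have := sliceBound_le μ i j
    rw [dif_neg (by omega), if_neg (by omega), add_zero]
    exact (Polynomial.natDegree_le_iff_coeff_eq_zero.1 (hA.1 i j) l (by omega)).symm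

theorem IsNormalForm.natDegree_le {A : Matrix (Fin (d + 1)) (Fin d) S[X]}
    (hA : IsNormalForm μ A) (i j : Fin d) : (A i.castSucc j).natDegree ≤ μ i := by
  rw [Polynomial.natDegree_le_iff_coeff_eq_zero]
  intro l hl
  rw [hA.2 i j l hl.le, if_neg]
  rintro ⟨rfl, rfl⟩
  exact lt_irrefl _ hl

theorem IsNormalForm.coeff_eq {A : Matrix (Fin (d + 1)) (Fin d) S[X]}
    (hA : IsNormalForm μ A) (i j : Fin d) :
    (A i.castSucc j).coeff (μ i) = (1 : Matrix (Fin d) (Fin d) S) i j := by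
  rw [hA.2 i j _ le_rfl, Matrix.one_apply]
  refine if_congr ⟨fun h => h.1, fun h => ⟨h, by rw [h]⟩⟩ rfl rfl

theorem IsNormalForm.minorCoeffs_last {A : Matrix (Fin (d + 1)) (Fin d) S[X]}
    (hA : IsNormalForm μ A) (hμ : ∑ j, μ j = n) :
    minorCoeffs n A (Fin.last d, Fin.last n) = (-1) ^ d := by
  rw [minorCoeffs, signedMinor, neg_one_pow_eq_C, Polynomial.coeff_C_mul, Fin.val_last,
    Fin.val_last]
  -- The row degree bounds of a normal form become column bounds after transposition; the matrix of
  -- leading coefficients is the identity.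
  have h : ((A.submatrix (Fin.last d).succAbove id).transpose).det.coeff (∑ j, μ j) = 1 := by
    rw [coeff_det_sum (b := μ) fun i j => by simpa using hA.natDegree_le j i]
    convert! Matrix.det_one (R := S) (n := Fin d) using 2
    ext i j
    simpa [Matrix.one_apply, eq_comm] using hA.coeff_eq j i
  rw [Matrix.det_transpose, hμ] at h
  rw [h, mul_one]

theorem isNormalForm_bidiagonal {k : Type*} [Field k] (hμ : ∀ j, 1 ≤ μ j) :
    IsNormalForm μ (bidiagonal k μ) := by
  refine ⟨natDegree_bidiagonal_le, fun i j l hl => ?_⟩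
  simp only [bidiagonal, Matrix.of_apply, Fin.castSucc_inj]
  by_cases h : i = j
  · simp [h, Polynomial.coeff_X_pow]
  · rw [if_neg h, if_neg (show ¬(i = j ∧ l = μ j) from fun h' => h h'.1)]
    split_ifs
    · rw [Polynomial.coeff_one, if_neg]
      have := hμ i
      omega
    · simp

theorem map_sliceMatrix (f : S →+* T) (z : SliceIndex μ → S) :
    (sliceMatrix μ z).map (Polynomial.mapRingHom f) = sliceMatrix μ fun q => f (z q) := by
  ext i j l
  simp only [Matrix.map_apply, Polynomial.coe_mapRingHom, Polynomial.coeff_map, coeff_sliceMatrix,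
    map_add]
  congr 1
  · split_ifs <;> simp
  · split_ifs <;> simp

/-- Column reduction: a vector of polynomials with small image under a normal form vanishes. -/
theorem IsNormalForm.eq_zero_of_mulVec {F : Type*} [Field F]
    {A : Matrix (Fin (d + 1)) (Fin d) F[X]} (hA : IsNormalForm μ A) {u : Fin d → F[X]}
    (hu : ∀ i : Fin d, A.mulVec u i.castSucc ∈ Polynomial.degreeLT F (μ i)) : u = 0 := by
  by_contra hne
  obtain ⟨j0, hj0⟩ : ∃ j, u j ≠ 0 := Function.ne_iff.1 hne
  obtain ⟨i, -, hi⟩ := Finset.exists_max_image Finset.univ (fun j => (u j).degree)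
    ⟨j0, Finset.mem_univ _⟩
  have hui : u i ≠ 0 := by
    intro h0
    have := hi j0 (Finset.mem_univ _)
    rw [h0, Polynomial.degree_zero, le_bot_iff, Polynomial.degree_eq_bot] at this
    exact hj0 this
  have hdeg : ∀ j, (u j).natDegree ≤ (u i).natDegree := fun j =>
    Polynomial.natDegree_le_natDegree (hi j (Finset.mem_univ _))
  have h0 := mem_degreeLT_iff_coeff.1 (hu i) (μ i + (u i).natDegree) (Nat.le_add_right _ _)
  -- With `u i` of maximal degree, only the monic diagonal entry of row `i` contributes in degree `μ
  -- i + deg (u i)`.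
  have h1 : (A.mulVec u i.castSucc).coeff (μ i + (u i).natDegree) = (u i).leadingCoeff := by
    rw [Matrix.mulVec, dotProduct, Polynomial.finsetSum_coeff, Finset.sum_eq_single i]
    · rw [Polynomial.coeff_mul_add_eq_of_natDegree_le (hA.natDegree_le i i) (hdeg i),
        hA.coeff_eq, Matrix.one_apply_eq, one_mul, Polynomial.leadingCoeff]
    · intro j _ hj
      rw [Polynomial.coeff_mul_add_eq_of_natDegree_le (hA.natDegree_le i j) (hdeg j),
        hA.coeff_eq, Matrix.one_apply_ne hj.symm, zero_mul]
    · simp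
  rw [h1, Polynomial.leadingCoeff_eq_zero] at h0
  exact hui h0

end Slice

/-! ### Reduction to normal form by column operations -/

section Reduction

variable {S T : Type*} [CommRing S] [CommRing T] {d n : ℕ} {μ : Fin d → ℕ}

/-- The positions of the coefficients of the `j`-th column that are prescribed in a normal form. -/
abbrev ReductionIndex (n : ℕ) (μ : Fin d → ℕ) (j : Fin d) : Type :=
  {q : Fin d × Fin (n + 1) // μ q.1 ≤ q.2 ∧ (q.2 : ℕ) ≤ μ j}

/-- The matrix of the linear system for reducing the `j`-th column to normal form by column
operations. -/
noncomputable def reductionMatrix (n : ℕ) (μ : Fin d → ℕ)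
    (A : Matrix (Fin (d + 1)) (Fin d) S[X]) (j : Fin d) :
    Matrix (ReductionIndex n μ j) (ReductionIndex n μ j) S :=
  Matrix.of fun q q' =>
    (A q.1.1.castSucc q'.1.1 * Polynomial.X ^ ((q'.1.2 : ℕ) - μ q'.1.1)).coeff q.1.2

theorem map_reductionMatrix (f : S →+* T) (A : Matrix (Fin (d + 1)) (Fin d) S[X]) (j : Fin d) :
    (reductionMatrix n μ A j).map f = reductionMatrix n μ (A.map (Polynomial.mapRingHom f)) j := by
  ext q q'
  simp only [reductionMatrix, Matrix.map_apply, Matrix.of_apply]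
  rw [← Polynomial.coeff_map]
  simp

/-- Multiplying row `i` of `g` by `X ^ μ i` multiplies the determinant by `X ^ (∑ μ i)`, yet the
column bounds keep its degree at most `∑ μ j`. -/
theorem natDegree_det_eq_zero {g : Matrix (Fin d) (Fin d) S[X]}
    (hg : ∀ i j, (Polynomial.X ^ μ i * g i j).natDegree ≤ μ j) : g.det.natDegree = 0 := by
  nontriviality S
  have h := natDegree_det_le (M := Matrix.diagonal (fun i => Polynomial.X ^ μ i) * g) (b := μ)
    fun i j => by rw [Matrix.diagonal_mul]; exact hg i j
  rw [Matrix.det_mul, Matrix.det_diagonal, Finset.prod_pow_eq_pow_sum] at h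
  by_cases h0 : g.det = 0
  · rw [h0, Polynomial.natDegree_zero]
  · rw [mul_comm, Polynomial.natDegree_mul_X_pow _ h0] at h
    omega

/-- The entry `g i j` has unknown coefficients in degrees `l - μ i` for `μ i ≤ l ≤ μ j`, and the
normal form prescribes the coefficients of `(A * g) i j` for the same `l`. So each column gives a
square linear system. -/
theorem exists_normalForm_mul {F : Type*} [Field F] (hle : ∀ j, μ j ≤ n)
    {A : Matrix (Fin (d + 1)) (Fin d) F[X]} (hA : ∀ i j, (A i j).natDegree ≤ μ j)
    (hdet : ∀ j, (reductionMatrix n μ A j).det ≠ 0) :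
    ∃ g : Matrix (Fin d) (Fin d) F[X], IsNormalForm μ (A * g) ∧ g.det.natDegree = 0 := by
  have hsolve : ∀ j, ∃ u, (reductionMatrix n μ A j).mulVec u =
      fun q => if q.1.1 = j ∧ (q.1.2 : ℕ) = μ j then 1 else 0 := by
    intro j
    have hu : IsUnit (reductionMatrix n μ A j) :=
      (Matrix.isUnit_iff_isUnit_det _).2 (isUnit_iff_ne_zero.2 (hdet j))
    exact Matrix.mulVec_surjective_iff_isUnit.2 hu _
  choose u hu using hsolve
  set g : Matrix (Fin d) (Fin d) F[X] := Matrix.of fun i j => ∑ q : ReductionIndex n μ j,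
    if q.1.1 = i then Polynomial.C (u j q) * Polynomial.X ^ ((q.1.2 : ℕ) - μ q.1.1) else 0 with hg
  have hAg : ∀ r j, (A * g) r j = ∑ q : ReductionIndex n μ j,
      Polynomial.C (u j q) * (A r q.1.1 * Polynomial.X ^ ((q.1.2 : ℕ) - μ q.1.1)) := by
    intro r j
    simp only [Matrix.mul_apply, hg, Matrix.of_apply, Finset.mul_sum]
    rw [Finset.sum_comm]
    refine Finset.sum_congr rfl fun q _ => ?_
    simp only [mul_ite, mul_zero]
    rw [Finset.sum_ite_eq Finset.univ, if_pos (Finset.mem_univ _)]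
    ring
  have hdeg : ∀ r j, ((A * g) r j).natDegree ≤ μ j := by
    intro r j
    rw [hAg]
    refine Polynomial.natDegree_sum_le_of_forall_le _ _ fun q _ => ?_
    refine (Polynomial.natDegree_C_mul_le _ _).trans ?_
    refine (Polynomial.natDegree_mul_le_of_le (hA _ _) (Polynomial.natDegree_X_pow_le _)).trans ?_
    have := q.2
    omega
  refine ⟨g, ⟨hdeg, fun i j l hl => ?_⟩, ?_⟩
  · by_cases hlj : l ≤ μ j
    · have hln : l < n + 1 := Nat.lt_succ_of_le (hlj.trans (hle j))
      have := congrFun (hu j) ⟨(i, ⟨l, hln⟩), hl, hlj⟩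
      simp only at this
      rw [← this, hAg, Polynomial.finsetSum_coeff, Matrix.mulVec, dotProduct]
      refine Finset.sum_congr rfl fun q _ => ?_
      rw [Polynomial.coeff_C_mul, mul_comm]
      rfl
    · rw [if_neg (by omega)]
      exact Polynomial.natDegree_le_iff_coeff_eq_zero.1 (hdeg _ _) l (by omega)
  · refine natDegree_det_eq_zero (μ := μ) fun i j => ?_
    simp only [hg, Matrix.of_apply, Finset.mul_sum]
    refine Polynomial.natDegree_sum_le_of_forall_le _ _ fun q _ => ?_
    split_ifs with h
    · subst h
      rw [mul_left_comm, ← pow_add]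
      refine (Polynomial.natDegree_C_mul_X_pow_le _ _).trans ?_
      have := q.2
      omega
    · simp

theorem exists_minorCoeffs_eq_mul_sliceMatrix {F : Type*} [Field F] (hμ : IsPartition μ n)
    {A : Matrix (Fin (d + 1)) (Fin d) F[X]} (hA : ∀ i j, (A i j).natDegree ≤ μ j)
    (hdet : ∀ j, (reductionMatrix n μ A j).det ≠ 0) :
    ∃ z : SliceIndex μ → F, minorCoeffs n A = fun p => z none * minorCoeffs n (sliceMatrix μ z) p := by
  obtain ⟨g, hNF, hg⟩ := exists_normalForm_mul hμ.le hA hdet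
  obtain ⟨c, hc⟩ := Polynomial.natDegree_eq_zero.1 hg
  have hm : ∀ p, minorCoeffs n (A * g) p = minorCoeffs n A p * c := by
    intro p
    rw [minorCoeffs, signedMinor_mul, ← hc, Polynomial.coeff_mul_C]
    rfl
  -- A normal form has a minor with top coefficient `± 1`, so the constant determinant `c` cannot
  -- vanish.
  have hc0 : c ≠ 0 := by
    rintro rfl
    have h1 := hNF.minorCoeffs_last hμ.sum_eq
    rw [hm, mul_zero] at h1
    exact pow_ne_zero _ (neg_ne_zero.2 one_ne_zero) h1.symm
  refine ⟨fun q => q.elim c⁻¹ fun p => ((A * g) p.1.1 p.1.2).coeff p.2, ?_⟩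
  rw [hNF.eq_sliceMatrix]
  ext p
  rw [hm]
  simp only [Option.elim_none]
  field_simp

/-- At the matrix with diagonal entries `X ^ μ j` and zeros elsewhere, the linear system is the
identity. -/
theorem det_reductionMatrix_ne_zero (k : Type*) [Field k] (n : ℕ) (j : Fin d) :
    (reductionMatrix n μ
      (coeffMatrix μ (X : _ → MvPolynomial (Fin (d + 1) × Fin d × ℕ) k)) j).det ≠ 0 := by
  let A : Matrix (Fin (d + 1)) (Fin d) k[X] :=
    Matrix.of fun i j => if i = j.castSucc then Polynomial.X ^ μ j else 0
  have hA : ∀ i j, (A i j).natDegree ≤ μ j := by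
    intro i j
    simp only [A, Matrix.of_apply]
    split_ifs <;> simp
  have h1 : reductionMatrix n μ A j = 1 := by
    ext q q'
    obtain ⟨⟨i, l⟩, hq⟩ := q
    obtain ⟨⟨i', l'⟩, hq'⟩ := q'
    simp only at hq hq'
    simp only [reductionMatrix, A, Matrix.of_apply, Matrix.one_apply, Subtype.mk.injEq,
      Prod.mk.injEq, Fin.castSucc_inj]
    by_cases h : i = i'
    · subst h
      rw [if_pos rfl, ← pow_add, Nat.add_sub_cancel' hq'.1, Polynomial.coeff_X_pow]
      simp [Fin.ext_iff]
    · simp [h]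
  intro h0
  have h2 := congrArg (eval fun p => (A p.1 p.2.1).coeff p.2.2) h0
  rw [RingHom.map_det, RingHom.mapMatrix_apply, map_reductionMatrix, map_coeffMatrix] at h2
  simp only [eval_X] at h2
  rw [coeffMatrix_coeff hA, h1, Matrix.det_one, map_zero] at h2
  exact one_ne_zero h2

end Reduction

/-! ### The vanishing ideal of the stratum -/

section VanishingIdeal

variable {k : Type*} [Field k] {d n : ℕ} {μ : Fin d → ℕ}

/-- The birational parametrization of the closure of the `μ`-stratum by normal forms. -/
noncomputable def sliceMap (k : Type*) [Field k] (n : ℕ) (μ : Fin d → ℕ)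
    (p : Fin (d + 1) × Fin (n + 1)) : MvPolynomial (SliceIndex μ) k :=
  X none * minorCoeffs n (sliceMatrix μ X) p

theorem map_sliceMap {L : Type*} [CommRing L] (f : MvPolynomial (SliceIndex μ) k →+* L)
    (p : Fin (d + 1) × Fin (n + 1)) :
    f (sliceMap k n μ p) =
      f (X none) * minorCoeffs n (sliceMatrix μ fun q => f (X q)) p := by
  rw [sliceMap, map_mul, map_minorCoeffs, map_sliceMatrix]

theorem eval_sliceMap (z : SliceIndex μ → k) (p : Fin (d + 1) × Fin (n + 1)) :
    eval z (sliceMap k n μ p) = z none * minorCoeffs n (sliceMatrix μ z) p := by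
  rw [map_sliceMap]
  simp only [eval_X]

theorem eval_bind_sliceMap (z : SliceIndex μ → k)
    (f : MvPolynomial (Fin (d + 1) × Fin (n + 1)) k) :
    eval z (bind₁ (sliceMap k n μ) f) =
      eval (fun p => z none * minorCoeffs n (sliceMatrix μ z) p) f := by
  rw [eval, eval₂Hom_bind₁]
  change eval₂ _ _ f = eval₂ _ _ f
  congr 1
  ext p
  exact eval_sliceMap z p

theorem slice_mem_muStratumCoeffs (hd : 0 < d) (hμ : IsPartition μ n) {z : SliceIndex μ → k}
    (h : n + n + 1 ≤ (mulMatrix n fun p => z none * minorCoeffs n (sliceMatrix μ z) p).rank) :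
    (fun p => z none * minorCoeffs n (sliceMatrix μ z) p) ∈ muStratumCoeffs k d n μ := by
  obtain ⟨A, hA, hAz⟩ :=
    exists_scaled_signedMinor hd (isNormalForm_sliceMatrix (S := k) z).1 (z none)
  have : (fun p => z none * minorCoeffs n (sliceMatrix μ z) p) = minorCoeffs n A := by
    ext p
    rw [minorCoeffs, minorCoeffs, hAz, Polynomial.coeff_mul_C, mul_comm]
  rw [this] at h ⊢
  rw [minorCoeffs_mem_iff hd hμ hA]
  refine le_antisymm ?_ h
  simpa using Matrix.rank_le_card_height (mulMatrix n (minorCoeffs n A))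

/-- The bidiagonal matrix is in normal form, so with scaling parameter `1` it is a parameter point
of full rank. -/
theorem exists_det_submatrix_sliceMap_ne_zero (k : Type*) [Field k] (hμ : IsPartition μ n) :
    ∃ (f : Fin (n + n + 1) → Fin (n + n + 1)) (g : Fin (n + n + 1) → Fin (d + 1) × Fin (n + 1)),
      ((mulMatrix n (sliceMap k n μ)).submatrix f g).det ≠ 0 := by
  obtain ⟨f, g, h⟩ := exists_det_submatrix_ne_zero _
    (rank_mulMatrix_bidiagonal (k := k) hμ.sum_eq).ge
  refine ⟨f, g, fun h0 => h ?_⟩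
  have hNF := isNormalForm_bidiagonal (k := k) hμ.pos
  have h1 := congrArg
    (eval fun q => q.elim 1 fun p => (bidiagonal k μ p.1.1 p.1.2).coeff p.2) h0
  rw [eval_det_submatrix, map_mulMatrix] at h1
  simp only [eval_sliceMap] at h1
  rw [hNF.eq_sliceMatrix] at h1
  simpa only [Option.elim_none, one_mul, map_zero] using h1

/-- The vanishing ideal of the `μ`-stratum is the kernel of the parametrization. -/
theorem vanishingIdeal_muStratumCoeffs [Infinite k] (hd : 0 < d) (hμ : IsPartition μ n) :
    vanishingIdeal k (muStratumCoeffs k d n μ) = RingHom.ker (bind₁ (sliceMap k n μ)) := by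
  ext f
  rw [mem_vanishingIdeal_iff, RingHom.mem_ker]
  constructor
  · intro h
    -- Wherever this determinant is nonzero the parameter maps into the stratum. Hence its product
    -- with the pullback of `f` vanishes identically.
    obtain ⟨r, g, hrg⟩ := exists_det_submatrix_sliceMap_ne_zero k hμ
    refine (mul_eq_zero.1 ?_).resolve_right hrg
    refine MvPolynomial.funext fun z => ?_
    rw [map_zero, map_mul, mul_eq_zero, or_iff_not_imp_right]
    intro hz
    rw [eval_det_submatrix, map_mulMatrix] at hz
    simp only [eval_sliceMap] at hz
    have := h _ (slice_mem_muStratumCoeffs hd hμ ((le_rank_iff_exists_det _).2 ⟨r, g, hz⟩))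
    rw [eval_bind_sliceMap]
    simpa using this
  · intro h x hx
    -- Off the zeros of the reduction determinants, the minors of a matrix are scaled minors of a
    -- normal form, where `f` vanishes; density does the rest.
    have h0 : bind₁ (minorMap k n μ) f = 0 := by
      have hprod : ∏ j, (reductionMatrix n μ
          (coeffMatrix μ (X : _ → MvPolynomial (Fin (d + 1) × Fin d × ℕ) k)) j).det ≠ 0 :=
        Finset.prod_ne_zero_iff.2 fun j _ => det_reductionMatrix_ne_zero k n j
      refine (mul_eq_zero.1 ?_).resolve_right hprod
      refine MvPolynomial.funext fun y => ?_
      rw [map_zero, map_mul, mul_eq_zero, or_iff_not_imp_right, map_prod]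
      intro hy
      replace hy := Finset.prod_ne_zero_iff.1 hy
      obtain ⟨z, hz⟩ := exists_minorCoeffs_eq_mul_sliceMatrix hμ (natDegree_coeffMatrix_le y)
        fun j => by
          have := hy j (Finset.mem_univ _)
          rw [RingHom.map_det, RingHom.mapMatrix_apply, map_reductionMatrix,
            map_coeffMatrix] at this
          simpa only [eval_X] using this
      rw [eval_bind_minorMap, hz, ← eval_bind_sliceMap, h, map_zero]
    obtain ⟨y, rfl⟩ := exists_minorCoeffs_eq hd hμ hx
    have := eval_bind_minorMap (μ := μ) y f
    rw [h0, map_zero] at this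
    simpa using this.symm

end VanishingIdeal

/-! ### Krull dimension and transcendence degree -/

section KrullDimension

/-- Lying over starts the lifted chain, going up extends it; a lifted step is strict because its
contraction is. -/
theorem exists_ltSeries_comap {A B : Type*} [CommRing A] [CommRing B] [Algebra A B]
    [Algebra.IsIntegral A B] (hinj : Function.Injective (algebraMap A B))
    (p : LTSeries (PrimeSpectrum A)) : ∃ q : LTSeries (PrimeSpectrum B),
      q.length = p.length ∧ PrimeSpectrum.comap (algebraMap A B) q.last = p.last := by
  induction p using RelSeries.inductionOn' with
  | singleton P =>
    obtain ⟨Q, -, hQ, hQP⟩ := Ideal.exists_ideal_over_prime_of_isIntegral P.asIdeal (⊥ : Ideal B) (by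
      rw [← RingHom.ker_eq_comap_bot, (RingHom.injective_iff_ker_eq_bot _).1 hinj]
      exact bot_le)
    exact ⟨RelSeries.singleton _ ⟨Q, hQ⟩, rfl, PrimeSpectrum.ext hQP⟩
  | snoc p P hP ih =>
    obtain ⟨q, hql, hqc⟩ := ih
    have hlt : p.last < P := hP
    obtain ⟨Q, hQge, hQ, hQP⟩ := Ideal.exists_ideal_over_prime_of_isIntegral P.asIdeal
      q.last.asIdeal (by
        have h1 : Ideal.comap (algebraMap A B) q.last.asIdeal = p.last.asIdeal :=
          congrArg PrimeSpectrum.asIdeal hqc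
        rw [h1]
        exact hlt.le)
    have hQlt : q.last < ⟨Q, hQ⟩ := by
      refine lt_of_le_of_ne hQge fun h => hlt.ne ?_
      rw [← hqc, h]
      exact PrimeSpectrum.ext hQP
    refine ⟨q.snoc ⟨Q, hQ⟩ hQlt, ?_, ?_⟩
    · simp [hql]
    · rw [RelSeries.last_snoc, RelSeries.last_snoc]
      exact PrimeSpectrum.ext hQP

theorem ringKrullDim_eq_of_isIntegral {A B : Type*} [CommRing A] [CommRing B] [Algebra A B]
    [Algebra.IsIntegral A B] (hinj : Function.Injective (algebraMap A B)) :
    ringKrullDim B = ringKrullDim A := by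
  apply le_antisymm
  · refine Order.krullDim_le_of_strictMono (PrimeSpectrum.comap (algebraMap A B)) ?_
    intro P Q hPQ
    exact Ideal.IsIntegral.comap_lt_comap (R := A) hPQ
  · refine iSup_le fun p => ?_
    obtain ⟨q, hq, -⟩ := exists_ltSeries_comap (B := B) hinj p
    rw [← hq]
    exact Order.LTSeries.length_le_krullDim q

universe u

/-- Noether normalization makes `B` integral over a polynomial ring in `s` variables; both
invariants equal `s`. -/
theorem ringKrullDim_eq_of_trdeg_eq {k B : Type u} [Field k] [CommRing B] [IsDomain B] [Algebra k B]
    [Algebra.FiniteType k B] {D : ℕ} (h : Algebra.trdeg k B = D) : ringKrullDim B = D := by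
  obtain ⟨s, g, hg, hint⟩ := exists_integral_inj_algHom_of_fg k B
  algebraize [g.toRingHom]
  have hinj : Function.Injective (algebraMap (MvPolynomial (Fin s) k) B) := hg
  have : FaithfulSMul (MvPolynomial (Fin s) k) B :=
    (faithfulSMul_iff_algebraMap_injective _ _).2 hinj
  have hI : Algebra.IsIntegral (MvPolynomial (Fin s) k) B := ⟨hint⟩
  have htower : IsScalarTower k (MvPolynomial (Fin s) k) B :=
    IsScalarTower.of_algebraMap_eq fun x => (g.commutes x).symm
  have h1 := trdeg_add_eq k (MvPolynomial (Fin s) k) (A := B)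
  rw [trdeg_eq_zero (R := MvPolynomial (Fin s) k) (A := B), add_zero,
    MvPolynomial.trdeg_of_isDomain, h] at h1
  have hs : s = D := by simpa using h1
  rw [ringKrullDim_eq_of_isIntegral hinj, MvPolynomial.ringKrullDim_of_isNoetherianRing,
    ringKrullDim_eq_zero_of_field, hs]
  simp

end KrullDimension

/-! ### Birationality of the parametrization and the dimension count -/

section Birational

variable {d n : ℕ} {μ : Fin d → ℕ}

/-- By the Bezout relation every syzygy is `A u`, and in normal form small upper entries force `u =
0`. -/
theorem IsNormalForm.eq_zero_of_syzygy {L : Type*} [Field L]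
    {A : Matrix (Fin (d + 1)) (Fin d) L[X]} (hA : IsNormalForm μ A)
    {b v : Fin (d + 1) → L[X]} (hb : ∑ i, b i * signedMinor A i = 1)
    (hv : ∑ i, signedMinor A i * v i = 0)
    (hdeg : ∀ i : Fin d, v i.castSucc ∈ Polynomial.degreeLT L (μ i)) : v = 0 := by
  obtain ⟨u, rfl⟩ := exists_mulVec_eq_of_bezout A hb hv
  rw [hA.eq_zero_of_mulVec hdeg, Matrix.mulVec_zero]

/-- The parameters of a normal form are rational functions of the coefficients of its minors. -/
theorem mem_range_of_slice {K L : Type*} [Field K] [Field L] [Algebra K L] (hμ : IsPartition μ n)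
    {z : SliceIndex μ → L} {x : Fin (d + 1) × Fin (n + 1) → L}
    (hx : ∀ p, x p = z none * minorCoeffs n (sliceMatrix μ z) p)
    (hr : (mulMatrix n x).rank = n + n + 1) (hK : ∀ p, x p ∈ Set.range (algebraMap K L))
    (q : SliceIndex μ) : z q ∈ Set.range (algebraMap K L) := by
  have hNF := isNormalForm_sliceMatrix z
  set A := sliceMatrix μ z with hA
  have htx : ∀ i, tuple x i = Polynomial.C (z none) * signedMinor A i := by
    intro i
    have h1 : x = z none • minorCoeffs n A := funext hx
    rw [h1, map_smul, Pi.smul_apply, tuple_minorCoeffs hNF.1 hμ.sum_eq, Polynomial.smul_eq_C_mul]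
  obtain ⟨b, hb⟩ := exists_bezout_of_rank hr
  have hb' : ∑ i, (b i * Polynomial.C (z none)) * signedMinor A i = 1 := by
    rw [← hb]
    exact Finset.sum_congr rfl fun i _ => by rw [htx, mul_assoc]
  have hz0 : Polynomial.C (z none) ≠ 0 := by
    intro h0
    simp [h0] at hb'
  rcases q with _ | ⟨⟨i, j⟩, l⟩
  -- The last minor of a normal form has top coefficient `(-1) ^ d`, so the scaling parameter is, up
  -- to sign, one of the coordinates of `x`.
  · obtain ⟨c, hc⟩ := hK (Fin.last d, Fin.last n)
    rw [hx, hNF.minorCoeffs_last hμ.sum_eq] at hc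
    refine ⟨c * (-1) ^ d, ?_⟩
    rw [map_mul, hc, map_pow, map_neg, map_one, mul_assoc, ← mul_pow]
    simp
  · obtain ⟨g, hg⟩ := LinearMap.exists_leftInverse_of_injective (Algebra.linearMap K L)
      (LinearMap.ker_eq_bot.2 (algebraMap K L).injective)
    have hg' : ∀ c, g (algebraMap K L c) = c := fun c => LinearMap.congr_fun hg c
    -- A `K`-linear projection of `L` onto `K`. Applied to the coefficients of column `j`, it gives
    -- another syzygy, as the tuple has coefficients in `K`.
    set ρ : L →ₗ[K] L := (Algebra.linearMap K L).comp g with hρ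
    have hρK : ∀ c, ρ (algebraMap K L c) = algebraMap K L c := fun c => by
      simp [hρ, hg']
    set w' : Fin (d + 1) → L[X] := fun i =>
      ∑ l ∈ Finset.range (μ j + 1), Polynomial.monomial l (ρ ((A i j).coeff l)) with hw'
    have hcoeff : ∀ i l, (w' i).coeff l = ρ ((A i j).coeff l) := by
      intro i l
      simp only [hw', Polynomial.finsetSum_coeff, Polynomial.coeff_monomial, Finset.sum_ite_eq',
        Finset.mem_range]
      split_ifs with hl
      · rfl
      · rw [Polynomial.natDegree_le_iff_coeff_eq_zero.1 (hNF.1 i j) l (by omega), map_zero]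
    have hsyz : ∑ i, tuple x i * A i j = 0 := by
      calc _ = Polynomial.C (z none) * ∑ i, signedMinor A i * A i j := by
            rw [Finset.mul_sum]
            exact Finset.sum_congr rfl fun i _ => by rw [htx, mul_assoc]
        _ = 0 := by rw [sum_signedMinor_mul, mul_zero]
    have hcoeffK : ∀ i l, ∃ c, algebraMap K L c = (tuple x i).coeff l := by
      intro i l
      rw [tuple_apply, coeff_ofCoeffs]
      split_ifs
      · exact hK _
      · exact ⟨0, map_zero _⟩
    have hsyz' : ∑ i, tuple x i * w' i = 0 := by
      ext m
      have h1 := congrArg (fun f => ρ (f.coeff m)) hsyz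
      simp only [Polynomial.finsetSum_coeff, Polynomial.coeff_mul, map_sum, Polynomial.coeff_zero,
        map_zero] at h1 ⊢
      rw [← h1]
      refine Finset.sum_congr rfl fun i _ => Finset.sum_congr rfl fun e _ => ?_
      obtain ⟨c, hc⟩ := hcoeffK i e.1
      rw [← hc, hcoeff, ← Algebra.smul_def, ← Algebra.smul_def, map_smul]
    -- The prescribed coefficients `0` and `1` are fixed by `ρ`, so the difference is a syzygy with
    -- small upper entries and vanishes. Column `j` thus has coefficients in `K`.
    have hzero : (fun i => A i j - w' i) = 0 := by
      refine hNF.eq_zero_of_syzygy hb' ?_ fun i => ?_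
      · apply mul_left_cancel₀ hz0
        rw [mul_zero, Finset.mul_sum]
        calc _ = ∑ i, tuple x i * A i j - ∑ i, tuple x i * w' i := by
              rw [← Finset.sum_sub_distrib]
              exact Finset.sum_congr rfl fun i _ => by rw [htx]; ring
          _ = 0 := by rw [hsyz, hsyz', sub_zero]
      · rw [mem_degreeLT_iff_coeff]
        intro l hl
        rw [Polynomial.coeff_sub, hcoeff, hNF.2 i j l hl]
        split_ifs
        · have := hρK 1
          rw [map_one] at this
          rw [this, sub_self]
        · rw [map_zero, sub_zero]
    have h1 := congrArg (fun f => f.coeff (l : ℕ)) (congrFun hzero i)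
    have hl := l.2
    simp only [Polynomial.coeff_sub, hcoeff, Pi.zero_apply, Polynomial.coeff_zero, sub_eq_zero,
      hA, coeff_sliceMatrix, dif_pos hl] at h1
    rw [if_neg, add_zero] at h1
    · exact ⟨_, h1.symm⟩
    · rintro ⟨rfl, h2⟩
      have h3 := sliceBound_castSucc μ j j
      have h4 := min_le_right (μ j + 1) (μ j)
      dsimp only at hl
      omega

variable {k : Type*} [Field k]

theorem rank_mulMatrix_sliceMap (hμ : IsPartition μ n) :
    (mulMatrix n fun p => algebraMap _ (FractionRing (MvPolynomial (SliceIndex μ) k))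
      (sliceMap k n μ p)).rank = n + n + 1 := by
  obtain ⟨f, g, h⟩ := exists_det_submatrix_sliceMap_ne_zero k hμ
  refine le_antisymm ?_ ((le_rank_iff_exists_det _).2 ⟨f, g, ?_⟩)
  · simpa using Matrix.rank_le_card_height (mulMatrix n fun p =>
      algebraMap _ (FractionRing (MvPolynomial (SliceIndex μ) k)) (sliceMap k n μ p))
  · rw [← map_mulMatrix, Matrix.submatrix_map]
    have h1 := RingHom.map_det (algebraMap _ (FractionRing (MvPolynomial (SliceIndex μ) k)))
      ((mulMatrix n (sliceMap k n μ)).submatrix f g)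
    rw [RingHom.mapMatrix_apply] at h1
    rw [← h1]
    exact (map_ne_zero_iff _ (IsFractionRing.injective _ _)).2 h

/-- `mem_range_of_slice` is applied with `L` the field of rational functions in the parameters and
`K` the subfield generated by the parametrization; denominators are then cleared. -/
theorem exists_mul_bind_sliceMap_eq (hμ : IsPartition μ n) (q : SliceIndex μ) :
    ∃ r s : MvPolynomial (Fin (d + 1) × Fin (n + 1)) k, bind₁ (sliceMap k n μ) s ≠ 0 ∧
      X q * bind₁ (sliceMap k n μ) s = bind₁ (sliceMap k n μ) r := by
  let L := FractionRing (MvPolynomial (SliceIndex μ) k)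
  let ι := algebraMap (MvPolynomial (SliceIndex μ) k) L
  have hι : Function.Injective ι := IsFractionRing.injective _ _
  let x : Fin (d + 1) × Fin (n + 1) → L := fun p => ι (sliceMap k n μ p)
  let K := IntermediateField.adjoin k (Set.range x)
  obtain ⟨c, hc⟩ := mem_range_of_slice (K := K) (L := L) hμ (z := fun q => ι (X q)) (x := x)
    (fun p => map_sliceMap ι p) (rank_mulMatrix_sliceMap hμ)
    (fun p => ⟨⟨x p, IntermediateField.subset_adjoin k _ ⟨p, rfl⟩⟩, rfl⟩) q
  have hmem : ι (X q) ∈ K := hc ▸ c.2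
  obtain ⟨r, s, hrs⟩ := (IntermediateField.mem_adjoin_range_iff k x _).1 hmem
  have haeval : ∀ f, aeval x f = ι (bind₁ (sliceMap k n μ) f) := by
    intro f
    have : aeval x = (IsScalarTower.toAlgHom k (MvPolynomial (SliceIndex μ) k) L).comp
        (bind₁ (sliceMap k n μ)) := by
      ext p
      simp [x, ι]
    rw [this]
    rfl
  rw [haeval, haeval] at hrs
  have hs : bind₁ (sliceMap k n μ) s ≠ 0 := by
    intro h0
    rw [h0, map_zero, div_zero, map_eq_zero_iff _ hι] at hrs
    exact X_ne_zero q hrs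
  refine ⟨r, s, hs, hι ?_⟩
  rw [map_mul, hrs, div_mul_cancel₀]
  exact (map_ne_zero_iff _ hι).2 hs

theorem isAlgebraic_range_sliceMap (hμ : IsPartition μ n) :
    Algebra.IsAlgebraic (bind₁ (sliceMap k n μ)).range (MvPolynomial (SliceIndex μ) k) := by
  set B := (bind₁ (sliceMap k n μ)).range
  have hX : ∀ q, IsAlgebraic B (X q : MvPolynomial (SliceIndex μ) k) := by
    intro q
    obtain ⟨r, s, hs, hrs⟩ := exists_mul_bind_sliceMap_eq (k := k) hμ q
    let r' : B := ⟨_, r, rfl⟩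
    let s' : B := ⟨_, s, rfl⟩
    refine ⟨Polynomial.C s' * Polynomial.X - Polynomial.C r', ?_, ?_⟩
    · intro h0
      have h1 := congrArg (fun f => f.coeff 1) h0
      simp only [Polynomial.coeff_sub, Polynomial.coeff_C_mul, Polynomial.coeff_X_one, mul_one,
        Polynomial.coeff_C_succ, sub_zero, Polynomial.coeff_zero] at h1
      exact hs (congrArg Subtype.val h1)
    · rw [map_sub, map_mul, Polynomial.aeval_C, Polynomial.aeval_C, Polynomial.aeval_X, sub_eq_zero]
      rw [mul_comm]
      exact hrs
  refine ⟨fun f => ?_⟩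
  induction f using MvPolynomial.induction_on with
  | C a => exact isAlgebraic_algebraMap (algebraMap k B a)
  | add p q hp hq => exact hp.add hq
  | mul_X p q hp => exact hp.mul (hX q)

theorem zariskiDim_muStratumCoeffs [Infinite k] (hd : 0 < d) (hμ : IsPartition μ n) :
    zariskiDim (muStratumCoeffs k d n μ) = (Fintype.card (SliceIndex μ) : ℕ) := by
  rw [zariskiDim, vanishingIdeal_muStratumCoeffs hd hμ,
    ringKrullDim_eq_of_ringEquiv
      (Ideal.quotientKerEquivRange (bind₁ (sliceMap k n μ))).toRingEquiv]
  have hfin : Algebra.FiniteType k (bind₁ (sliceMap k n μ)).range :=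
    Algebra.FiniteType.of_surjective (bind₁ (sliceMap k n μ)).rangeRestrict
      (AlgHom.rangeRestrict_surjective _)
  apply ringKrullDim_eq_of_trdeg_eq (k := k)
  have halg := isAlgebraic_range_sliceMap (k := k) hμ
  have h1 := trdeg_add_eq k (bind₁ (sliceMap k n μ)).range
    (A := MvPolynomial (SliceIndex μ) k)
  rw [trdeg_eq_zero (R := (bind₁ (sliceMap k n μ)).range), add_zero,
    MvPolynomial.trdeg_of_isDomain] at h1
  rw [h1]
  simp only [Cardinal.mk_fintype, Cardinal.lift_natCast]

/-- Since `min (μ j + 1) (μ i) = μ i - max(0, μ i - μ j - 1)`, the upper block contributes `d n`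
minus the correction; the correction is zero for `j ≥ i`. The last row adds `n + d` and the scaling
parameter `1`. -/
theorem card_sliceIndex (hμ : IsPartition μ n) :
    (Fintype.card (SliceIndex μ) : ℤ) = ((d : ℤ) + 1) * ((n : ℤ) + 1) -
      ∑ i : Fin d, ∑ j ∈ Finset.univ.filter (fun j : Fin d => j < i),
        max 0 ((μ i : ℤ) - (μ j : ℤ) - 1) := by
  have hsum : ∑ j, (μ j : ℤ) = n := by exact_mod_cast hμ.sum_eq
  have hterm : ∀ i j, ((min (μ j + 1) (μ i) : ℕ) : ℤ) =
      μ i - if j < i then max 0 ((μ i : ℤ) - (μ j : ℤ) - 1) else 0 := by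
    intro i j
    split_ifs with h
    · omega
    · have := hμ.mono (not_lt.1 h)
      omega
  rw [Fintype.card_option, Fintype.card_sigma, Fintype.sum_prod_type, Fin.sum_univ_castSucc]
  simp only [Fintype.card_fin, sliceBound_last, sliceBound_castSucc]
  push_cast [Finset.sum_filter]
  simp only [← Nat.cast_one (R := ℤ), ← Nat.cast_add, ← Nat.cast_min, hterm]
  simp only [Finset.sum_sub_distrib, Finset.sum_const, Finset.card_univ, Fintype.card_fin,
    nsmul_eq_mul, ← Finset.mul_sum, hsum]
  push_cast [Finset.sum_add_distrib]
  rw [hsum]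
  simp
  ring

end Birational

end MuStrata

theorem theorem3p2 {k : Type*} [Field k] [Infinite k] (d n : ℕ) (hd : 2 ≤ d)
    (μ : Fin d → ℕ) (hμ : MuStrata.IsPartition μ n) :
    (∃ Z U : Set (Fin (d + 1) × Fin (n + 1) → k),
      IsClosed[MuStrata.zariski k (Fin (d + 1) × Fin (n + 1))] Z ∧
      IsOpen[MuStrata.zariski k (Fin (d + 1) × Fin (n + 1))] U ∧
      MuStrata.muStratumCoeffs k d n μ = Z ∩ U) ∧
    @IsIrreducible _ (MuStrata.zariski k (Fin (d + 1) × Fin (n + 1)))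
      (MuStrata.muStratumCoeffs k d n μ) ∧
    ∃ D : ℕ, MuStrata.zariskiDim (MuStrata.muStratumCoeffs k d n μ) = D ∧
      (D : ℤ) = ((d : ℤ) + 1) * ((n : ℤ) + 1) -
        ∑ i : Fin d, ∑ j ∈ Finset.univ.filter (fun j : Fin d => j < i),
          max 0 ((μ i : ℤ) - (μ j : ℤ) - 1) := by
  have hd' : 0 < d := by omega
  exact ⟨MuStrata.exists_isClosed_inter_isOpen hd' hμ,
    MuStrata.isIrreducible_muStratumCoeffs hd' hμ, _,
    MuStrata.zariskiDim_muStratumCoeffs hd' hμ, MuStrata.card_sliceIndex hμ⟩
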